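/- Setting. Let $N_s,N_r\ge 0$ and $M\ge 1$ be integers, $\mathcal M=\{1,\dots,M\}$, and let $\mathcal H$ consist of channels $\mathbf h_1,\mathbf g_{1,m}\in\mathbb C^{N_s}$, $\mathbf F_1\in\mathbb C^{N_s\times N_r}$, $\mathbf h_2,\mathbf g_{2,m}\in\mathbb C^{N_r}$ ($m\in\mathcal M$). Let $\boldsymbol\theta\in\mathbb R^{N_r}$, $\boldsymbol\Theta=\mathrm{diag}(e^{\jmath\theta_1},\dots,e^{\jmath\theta_{N_r}})$, and put $\tilde{\mathbf h}^H=\mathbf h_2^H\boldsymbol\Theta^H\mathbf F_1^H+\mathbf h_1^H$, $\tilde{\mathbf g}_m^H=\mathbf g_{2,m}^H\boldsymbol\Theta^H\mathbf F_1^H+\mathbf g_{1,m}^H$. Let $\sigma_I>0$, $\sigma_{E,m}>0$, $p>0$, $P_t\in\mathbb R$, $\epsilon_m\in\mathbb R$. For $\mathbf w\in\mathbb C^{N_s}$ and $\mathbf P\in\mathbb C^{N_s\times M}$ let $$\mathrm{SINR}^I=\frac{|\tilde{\mathbf h}^H\mathbf w|^2}{\|\tilde{\mathbf h}^H\mathbf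 P\|^2+\sigma_I^2},\quad \mathrm{SINR}^E_m=\frac{|\tilde{\mathbf g}_m^H\mathbf w|^2}{\|\tilde{\mathbf g}_m^H\mathbf P\|^2+\sigma_{E,m}^2},\quad Q_m=|\tilde{\mathbf g}_m^H\mathbf w|^2+\|\tilde{\mathbf g}_m^H\mathbf P\|^2 .$$ The short-term problem $\mathcal P_S(\boldsymbol\theta,\mathcal H)$ is to maximize $\bar S(\mathbf w,\mathbf P)=\log(1+\mathrm{SINR}^I)-\frac1p\log\sum_{m}(1+\mathrm{SINR}^E_m)^p$ subject to $\|\mathbf w\|^2+\|\mathbf P\|^2\le P_t$ and $Q_m\ge\epsilon_m$ for all $m$ (Euclidean and Frobenius norms). With $e(\mathbf w,\mathbf P,u)=|u|^2\big(|\tilde{\mathbf h}^H\mathbf w|^2+\sigma_I^2+\|\tilde{\mathbf h}^H\mathbf P\|^2\big)+1-2\Re\{u^*\tilde{\mathbf h}^H\mathbf w\}$, the reformulated problem is to minimize the surrogate objective $$\bar E(\mathbf w,\mathbf P,z,u,v,y)=z\,e(\mathbf w,\mathbf P,u)-\log z+\tfrac1p v\sum_m(1+y_m)^p-\tfrac1p\log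 v$$ over $\mathbf w,\mathbf P$, $z>0$, $v>0$, $u\in\mathbb C$, $y\in\mathbb R^M$, subject to $\mathrm{SINR}^E_m\le y_m$ and $Q_m\ge\epsilon_m$ for all $m$ and $\|\mathbf w\|^2+\|\mathbf P\|^2\le P_t$. Algorithm (CCCP-BCD). Start at a feasible point $(\mathbf w^0,\mathbf P^0,z^0,u^0,v^0,y^0)$ of the reformulated problem. Given the $i$-th iterate, (1) let $(z^{i+1},v^{i+1})$ minimize $\bar E(\mathbf w^i,\mathbf P^i,z,u^i,v,y^i)$ over $z,v>0$; (2) let $u^{i+1}$ minimize $e(\mathbf w^i,\mathbf P^i,u)$ over $u\in\mathbb C$; (3) with $(\mathbf w^f,\mathbf P^f)=(\mathbf w^i,\mathbf P^i)$, let $(\mathbf w^{i+1},\mathbf P^{i+1},y^{i+1})$ be a global minimizer of $\bar E(\mathbf w,\mathbf P,z^{i+1},u^{i+1},v^{i+1},y)$ subject to $\|\mathbf w\|^2+\|\mathbf P\|^2\le P_t$ and, for all $m$, $$\frac{|\tilde{\mathbf g}_m^H\mathbf w|^2}{d_m}\le y_m,\qquad d_m:=-\|\tilde{\mathbf g}_m^H\mathbf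 P^f\|^2+2\Re\{\tilde{\mathbf g}_m^H\mathbf P^f\mathbf P^H\tilde{\mathbf g}_m\}+\sigma_{E,m}^2>0,$$ $$-|\tilde{\mathbf g}_m^H\mathbf w^f|^2-\|\tilde{\mathbf g}_m^H\mathbf P^f\|^2+2\Re\{\tilde{\mathbf g}_m^H\mathbf w^f\mathbf w^H\tilde{\mathbf g}_m+\tilde{\mathbf g}_m^H\mathbf P^f\mathbf P^H\tilde{\mathbf g}_m\}\ge\epsilon_m .$$ Theorem. For every infinite sequence of iterates generated in this way: (a) $\bar E(\mathbf w^i,\mathbf P^i,z^i,u^i,v^i,y^i)$ is non-increasing in $i$; (b) every iterate is feasible for the reformulated problem; (c) let $(\mathbf w^\star,\mathbf P^\star,z^\star,u^\star,v^\star,y^\star)$ be a limit point (the limit of a subsequence) of the iterates, and suppose that the constraints of step (3) with $(\mathbf w^f,\mathbf P^f)=(\mathbf w^\star,\mathbf P^\star)$ satisfy Slater's condition, i.e. some $(\mathbf w,\mathbf P,y)$ satisfies all of them strictly. Then the limit point satisfies the KKT conditions of the reformulated problem, and $(\mathbf w^\star,\mathbf P^\star)$ satisfies the KKT conditions of $\mathcal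 P_S(\boldsymbol\theta,\mathcal H)$, i.e. it is a stationary solution of $\mathcal P_S(\boldsymbol\theta,\mathcal H)$. -/

import Mathlib

open Matrix Filter Topology

noncomputable section

namespace SecureSWIPT

/-! ### Finite-dimensional inequality-constrained minimization -/

/-- Minimize `obj x` over `x ∈ dom` subject to `con j x ≤ 0` for all `j`. The set `dom` is the
implicit domain, on which the expressions in the problem make sense. -/
structure OptProblem (E ι : Type) where
  dom : Set E
  obj : E → ℝ
  con : ι → E → ℝ

namespace OptProblem

variable {E ι : Type}

def Feasible (Q : OptProblem E ι) (x : E) : Prop :=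
  x ∈ Q.dom ∧ ∀ j, Q.con j x ≤ 0

/-- `x` is a global minimizer. -/
def IsMinimizer (Q : OptProblem E ι) (x : E) : Prop :=
  Q.Feasible x ∧ ∀ x', Q.Feasible x' → Q.obj x ≤ Q.obj x'

/-- Slater's condition: all inequality constraints can be satisfied strictly. -/
def Slater (Q : OptProblem E ι) : Prop :=
  ∃ x ∈ Q.dom, ∀ j, Q.con j x < 0

/-- The Karush-Kuhn-Tucker conditions: primal feasibility, and multipliers `μ` with dual
feasibility, complementary slackness and stationarity of the Lagrangian. Complex variables are
treated as pairs of real ones. Differentiability is part of the condition. -/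
def IsKKT [NormedAddCommGroup E] [NormedSpace ℝ E] [Fintype ι]
    (Q : OptProblem E ι) (x : E) : Prop :=
  Q.Feasible x ∧ Q.dom ∈ 𝓝 x ∧ DifferentiableAt ℝ Q.obj x ∧
    (∀ j, DifferentiableAt ℝ (Q.con j) x) ∧
    ∃ μ : ι → ℝ, (∀ j, 0 ≤ μ j) ∧ (∀ j, μ j * Q.con j x = 0) ∧
      fderiv ℝ Q.obj x + ∑ j, μ j • fderiv ℝ (Q.con j) x = 0

end OptProblem

/-! ### System model -/

/-- One realization of all channels: `h1`, `F1`, `g1 m` are the (conjugate transposed) channels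
from the base station to the information user, to the surface and to energy user `m`; `h2`, `g2 m`
are those from the surface to the information user and to energy user `m`. -/
structure Channels (Ns Nr M : ℕ) where
  h1 : Fin Ns → ℂ
  F1 : Matrix (Fin Ns) (Fin Nr) ℂ
  g1 : Fin M → Fin Ns → ℂ
  h2 : Fin Nr → ℂ
  g2 : Fin M → Fin Nr → ℂ

/-- Noise standard deviations, power budget, harvesting requirements, smoothing parameter. -/
structure Params (M : ℕ) where
  σI : ℝ
  σE : Fin M → ℝ
  Pt : ℝ
  ε : Fin M → ℝ
  p : ℝ

/-- A pair `(w, P)`: information beam `w`, and `P k` the `k`-th column of the energy beamforming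
matrix. -/
abbrev Beam (Ns M : ℕ) : Type := (Fin Ns → ℂ) × (Fin M → Fin Ns → ℂ)

/-- All the variables `(w, P), z, u, v, y` of the reformulated problem. -/
abbrev Vars (Ns M : ℕ) : Type := Beam Ns M × ℝ × ℂ × ℝ × (Fin M → ℝ)

variable {Ns Nr M : ℕ}

/-- Reflection-coefficient matrix `diag(e^{jθ₁}, …)`. -/
def reflection (θ : Fin Nr → ℝ) : Matrix (Fin Nr) (Fin Nr) ℂ :=
  Matrix.diagonal fun n => Complex.exp (Complex.I * (θ n : ℂ))

/-- The effective row channel `h₂ᴴ Θᴴ F₁ᴴ + h₁ᴴ` to the information user. -/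
def hEff (H : Channels Ns Nr M) (θ : Fin Nr → ℝ) : Fin Ns → ℂ :=
  (star H.h2 ᵥ* (reflection θ)ᴴ) ᵥ* H.F1ᴴ + star H.h1

/-- The effective row channel `g₂,ₘᴴ Θᴴ F₁ᴴ + g₁,ₘᴴ` to energy user `m`. -/
def gEff (H : Channels Ns Nr M) (θ : Fin Nr → ℝ) (m : Fin M) : Fin Ns → ℂ :=
  (star (H.g2 m) ᵥ* (reflection θ)ᴴ) ᵥ* H.F1ᴴ + star (H.g1 m)

/-- `|a w|²` for a row vector `a`. -/
def infoGain (a : Fin Ns → ℂ) (b : Beam Ns M) : ℝ := ‖a ⬝ᵥ b.1‖ ^ 2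

/-- `‖a P‖²` for a row vector `a`. -/
def energyGain (a : Fin Ns → ℂ) (b : Beam Ns M) : ℝ := ∑ k, ‖a ⬝ᵥ b.2 k‖ ^ 2

/-- `-|a w^f|² + 2 Re {a w^f wᴴ aᴴ}`, the first-order expansion of `|a w|²` at `w^f`. -/
def infoGainLin (a : Fin Ns → ℂ) (f b : Beam Ns M) : ℝ :=
  -infoGain a f + 2 * ((a ⬝ᵥ f.1) * star (a ⬝ᵥ b.1)).re

/-- `-‖a P^f‖² + 2 Re {a P^f Pᴴ aᴴ}`, the first-order expansion of `‖a P‖²` at `P^f`. -/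
def energyGainLin (a : Fin Ns → ℂ) (f b : Beam Ns M) : ℝ :=
  -energyGain a f + 2 * (∑ k, (a ⬝ᵥ f.2 k) * star (a ⬝ᵥ b.2 k)).re

/-- Transmit power `‖w‖² + ‖P‖²` (Euclidean and Frobenius norms). -/
def power (b : Beam Ns M) : ℝ := ∑ n, ‖b.1 n‖ ^ 2 + ∑ k, ∑ n, ‖b.2 k n‖ ^ 2

section Problems

variable (H : Channels Ns Nr M) (θ : Fin Nr → ℝ) (c : Params M)

def sinrI (b : Beam Ns M) : ℝ :=
  infoGain (hEff H θ) b / (energyGain (hEff H θ) b + c.σI ^ 2)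

def sinrE (m : Fin M) (b : Beam Ns M) : ℝ :=
  infoGain (gEff H θ m) b / (energyGain (gEff H θ m) b + c.σE m ^ 2)

/-- Received RF power of energy user `m`. -/
def rfPower (m : Fin M) (b : Beam Ns M) : ℝ :=
  infoGain (gEff H θ m) b + energyGain (gEff H θ m) b

/-- The smoothed worst-case secrecy rate. -/
def secrecyRate (b : Beam Ns M) : ℝ :=
  Real.log (1 + sinrI H θ c b) -
    1 / c.p * Real.log (∑ m, (1 + sinrE H θ c m b) ^ c.p)

/-- The short-term problem: maximize the smoothed secrecy rate (that is, minimize its negative)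
under the energy harvesting constraints and the power constraint. -/
def shortTerm : OptProblem (Beam Ns M) (Fin M ⊕ Unit) where
  dom := Set.univ
  obj b := -secrecyRate H θ c b
  con
    | .inl m => fun b => c.ε m - rfPower H θ m b
    | .inr _ => fun b => power b - c.Pt

/-- The mean-square-error function `e(w, P, u)`. -/
def mse (b : Beam Ns M) (u : ℂ) : ℝ :=
  ‖u‖ ^ 2 * infoGain (hEff H θ) b + ‖u‖ ^ 2 * c.σI ^ 2 + ‖u‖ ^ 2 * energyGain (hEff H θ) b
    + 1 - 2 * (star u * (hEff H θ ⬝ᵥ b.1)).re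

/-- The surrogate objective
`z e(w, P, u) - log z + (1/p) v ∑ₘ (1 + yₘ)^p - (1/p) log v`. -/
def surrogate (x : Vars Ns M) : ℝ :=
  match x with
  | (b, z, u, v, y) =>
    z * mse H θ c b u - Real.log z + 1 / c.p * v * (∑ m, (1 + y m) ^ c.p)
      - 1 / c.p * Real.log v

/-- The reformulated problem in all variables; `z` and `v` are positive because of the
logarithms. -/
def reformulated : OptProblem (Vars Ns M) (Fin M ⊕ Fin M ⊕ Unit) where
  dom := {x | 0 < x.2.1 ∧ 0 < x.2.2.2.1}
  obj := surrogate H θ c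
  con
    | .inl m => fun x => sinrE H θ c m x.1 - x.2.2.2.2 m
    | .inr (.inl m) => fun x => c.ε m - rfPower H θ m x.1
    | .inr (.inr _) => fun x => power x.1 - c.Pt

/-! ### The algorithm -/

/-- First block, variables `(z, v)`. -/
def step1 (b : Beam Ns M) (u : ℂ) (y : Fin M → ℝ) : OptProblem (ℝ × ℝ) Empty where
  dom := {q | 0 < q.1 ∧ 0 < q.2}
  obj q := surrogate H θ c (b, q.1, u, q.2, y)
  con := Empty.elim

/-- Second block, variable `u`. -/
def step2 (b : Beam Ns M) : OptProblem ℂ Empty where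
  dom := Set.univ
  obj u := mse H θ c b u
  con := Empty.elim

/-- The denominator in the convexified signal-to-interference-plus-noise constraint. -/
def denLin (f : Beam Ns M) (m : Fin M) (b : Beam Ns M) : ℝ :=
  energyGainLin (gEff H θ m) f b + c.σE m ^ 2

/-- Third block, variables `((w, P), y)`, with the constraints convexified at `f = (w^f, P^f)`.
As usual for a quadratic-over-linear constraint, the denominators are positive on the domain of
the problem. -/
def step3 (f : Beam Ns M) (z : ℝ) (u : ℂ) (v : ℝ) :
    OptProblem (Beam Ns M × (Fin M → ℝ)) (Fin M ⊕ Fin M ⊕ Unit) where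
  dom := {q | ∀ m, 0 < denLin H θ c f m q.1}
  obj q := surrogate H θ c (q.1, z, u, v, q.2)
  con
    | .inl m => fun q => infoGain (gEff H θ m) q.1 / denLin H θ c f m q.1 - q.2 m
    | .inr (.inl m) => fun q =>
        c.ε m - (infoGainLin (gEff H θ m) f q.1 + energyGainLin (gEff H θ m) f q.1)
    | .inr (.inr _) => fun q => power q.1 - c.Pt

/-- One iteration of the algorithm takes the first argument to the second: `(z, v)`, `u` and
`(w, P, y)` are successively updated by global minimizers of the three block problems, where the
third one is convexified at the beams of the previous iterate. -/
def IsIteration : Vars Ns M → Vars Ns M → Prop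
  | (b, _, u, _, y), (b', z', u', v', y') =>
    (step1 H θ c b u y).IsMinimizer (z', v') ∧
    (step2 H θ c b).IsMinimizer u' ∧
    (step3 H θ c b z' u' v').IsMinimizer (b', y')

/-- `x` is a sequence of iterates of the algorithm started at a feasible point. -/
def IsRun (x : ℕ → Vars Ns M) : Prop :=
  (reformulated H θ c).Feasible (x 0) ∧ ∀ i, IsIteration H θ c (x i) (x (i + 1))

/-- `x` is a limit point of the sequence `xs`: the limit of a subsequence. -/
def IsLimitPoint {X : Type} [TopologicalSpace X] (xs : ℕ → X) (x : X) : Prop :=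
  ∃ φ : ℕ → ℕ, StrictMono φ ∧ Tendsto (xs ∘ φ) atTop (𝓝 x)

/-- Constraint qualification at `x = ((w, P), z, u, v, y)`: the constraints of the third block
problem, convexified at `(w, P)` itself, satisfy Slater's condition. -/
def SlaterAt (x : Vars Ns M) : Prop :=
  (step3 H θ c x.1 x.2.1 x.2.2.1 x.2.2.2.1).Slater

end Problems

end SecureSWIPT

end

/-! The surrogate dualizes the logarithms of the secrecy rate. Since `1 + log e ≤ z * e - log z`,
with equality only at `z = e⁻¹`, and since `mse` is a quadratic in `u` with minimum `(1 + SINR)⁻¹`,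
minimizing over `z`, `u`, `v` with `y` equal to the eavesdroppers' SINRs returns the negative rate
plus `1 + 1 / p`.

Linearizing a convex quadratic gives a minorant that touches it at the expansion point. So the
constraints of the third block majorize the true ones (`blockCon_le_step3_con`), agree with them at
the previous iterate (`step3_con_self`) and have the same gradient there (`fderiv_step3_con_self`).
The first fact gives feasibility; with the second, the previous iterate remains a competitor, which
gives descent.

At a limit point the surrogate is at most its value at every iterate. The next iterates need not
converge along the subsequence, but their `z`, `v`, `u` are continuous functions of convergent data,
and uniqueness of the block minimizers identifies the limits (`block_optimal_of_isLimitPoint`). A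
point strictly feasible for the limiting third block is eventually feasible along the subsequence,
so it cannot beat the limit. Slater's condition and separation turn this into multipliers
(`step3_isKKT`), which tangency transfers to the reformulated problem (`reformulated_isKKT`).
Stationarity in `y` forces the SINR constraints to be tight, and pulling the KKT system back along
`y = sinrE` eliminates them (`shortTerm_isKKT`). -/

namespace SecureSWIPT

/-! ### Directional derivatives, touching functions, tangent inequalities -/

section Calculus

variable {E : Type*} [NormedAddCommGroup E] [NormedSpace ℝ E]

lemma hasDerivAt_line {f : E → ℝ} {x : E} (hf : DifferentiableAt ℝ f x) (d : E) :
    HasDerivAt (fun t : ℝ => f (x + t • d)) (fderiv ℝ f x d) 0 := by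
  have h1 : HasDerivAt (fun t : ℝ => x + t • d) d 0 := by
    simpa using ((hasDerivAt_id (0 : ℝ)).smul_const d).const_add x
  have h2 : HasFDerivAt f (fderiv ℝ f x) (x + (0 : ℝ) • d) := by
    simpa using hf.hasFDerivAt
  exact h2.comp_hasDerivAt (0 : ℝ) h1

lemma tendsto_line (x d : E) : Tendsto (fun t : ℝ => x + t • d) (𝓝[>] 0) (𝓝 x) := by
  have : Continuous fun t : ℝ => x + t • d := by fun_prop
  simpa using (this.tendsto 0).mono_left nhdsWithin_le_nhds

lemma tendsto_slope_line {f : E → ℝ} {x : E} (hf : DifferentiableAt ℝ f x) (d : E) :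
    Tendsto (fun t : ℝ => t⁻¹ * (f (x + t • d) - f x)) (𝓝[>] 0) (𝓝 (fderiv ℝ f x d)) := by
  have h := (hasDerivAt_line hf d).tendsto_slope_zero_right
  simpa using h

lemma eventually_lt_of_fderiv_neg {f : E → ℝ} {x d : E} (hf : DifferentiableAt ℝ f x)
    (hd : fderiv ℝ f x d < 0) : ∀ᶠ t : ℝ in 𝓝[>] 0, f (x + t • d) < f x := by
  filter_upwards [(tendsto_slope_line hf d).eventually_lt_const hd, self_mem_nhdsWithin]
    with t ht (ht0 : 0 < t)
  have := neg_of_mul_neg_right ht (inv_nonneg.2 ht0.le)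
  linarith

lemma fderiv_nonneg_of_eventually_le {f : E → ℝ} {x d : E} (hf : DifferentiableAt ℝ f x)
    (h : ∀ᶠ t : ℝ in 𝓝[>] 0, f x ≤ f (x + t • d)) : 0 ≤ fderiv ℝ f x d := by
  by_contra! hd
  obtain ⟨t, h1, h2⟩ := (h.and (eventually_lt_of_fderiv_neg hf hd)).exists
  exact absurd h2 (not_lt.2 h1)

/-- Two differentiable functions that touch have the same derivative. -/
lemma fderiv_eq_of_eventually_le {f g : E → ℝ} {x : E} (hf : DifferentiableAt ℝ f x)
    (hg : DifferentiableAt ℝ g x) (hle : ∀ᶠ x' in 𝓝 x, f x' ≤ g x') (heq : f x = g x) :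
    fderiv ℝ f x = fderiv ℝ g x := by
  have hmin : IsLocalMin (g - f) x := by
    filter_upwards [hle] with x' hx'
    simp only [Pi.sub_apply]
    linarith
  have := hmin.fderiv_eq_zero
  rw [fderiv_sub hg hf, sub_eq_zero] at this
  exact this.symm

/-- The tangent inequality of a convex function. -/
lemma add_fderiv_le_of_convexOn {s : Set E} {f : E → ℝ} (hc : ConvexOn ℝ s f) {x x' : E}
    (hx : x ∈ s) (hx' : x' ∈ s) (hf : DifferentiableAt ℝ f x) :
    f x + fderiv ℝ f x (x' - x) ≤ f x' := by
  suffices h : fderiv ℝ f x (x' - x) ≤ f x' - f x by linarith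
  refine le_of_tendsto (tendsto_slope_line hf (x' - x)) ?_
  filter_upwards [Ioo_mem_nhdsGT (zero_lt_one (α := ℝ))] with t ht
  have h := hc.2 hx hx' (sub_nonneg.2 ht.2.le) ht.1.le (by ring)
  have e : (1 - t) • x + t • x' = x + t • (x' - x) := by module
  rw [e, smul_eq_mul, smul_eq_mul] at h
  rw [inv_mul_le_iff₀ ht.1]
  linarith

end Calculus

/-! ### Multipliers by separation, and a KKT criterion -/

/-- Strict linear inequalities without a common solution have nontrivial Lagrange multipliers. -/
lemma exists_multipliers {E ι : Type*} [AddCommGroup E] [Module ℝ E] [Fintype ι]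
    (A₀ : E →ₗ[ℝ] ℝ) (A : ι → E →ₗ[ℝ] ℝ) (k : ι → ℝ) (hk : ∀ j, k j ≤ 0)
    (d₀ : E) (hd₀ : ∀ j, k j + A j d₀ < 0)
    (h : ∀ d, (∀ j, k j + A j d < 0) → 0 ≤ A₀ d) :
    ∃ μ : ι → ℝ, (∀ j, 0 ≤ μ j) ∧ (∀ j, μ j * k j = 0) ∧ ∀ d, A₀ d + ∑ j, μ j * A j d = 0 := by
  classical
  -- All pairs strictly above the attained values of objective and constraints. The set is convex,
  -- open because of the strict inequalities, and misses the origin by `h`; separating it from the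
  -- origin yields the multipliers.
  let S : Set (ℝ × (ι → ℝ)) := {q | ∃ d, A₀ d < q.1 ∧ ∀ j, k j + A j d < q.2 j}
  have hSc : Convex ℝ S := by
    rintro q ⟨d, hd, hd'⟩ r ⟨e, he, he'⟩ a b ha hb hab
    refine ⟨a • d + b • e, ?_, fun j => ?_⟩
    · have : a * A₀ d + b * A₀ e < a * q.1 + b * r.1 := by
        rcases ha.eq_or_lt with rfl | ha
        · obtain rfl : b = 1 := by linarith
          simpa using he
        · nlinarith
      simpa using this
    · have : a * (k j + A j d) + b * (k j + A j e) < a * q.2 j + b * r.2 j := by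
        have h1 := hd' j
        have h2 := he' j
        rcases ha.eq_or_lt with rfl | ha
        · obtain rfl : b = 1 := by linarith
          simpa using h2
        · nlinarith
      have e1 : k j = a * k j + b * k j := by rw [← add_mul, hab, one_mul]
      simp only [map_add, map_smul, smul_eq_mul, Prod.snd_add, Prod.smul_snd, Pi.add_apply,
        Pi.smul_apply]
      linarith
  have hSo : IsOpen S := by
    have : S = ⋃ d, ({q | A₀ d < q.1} ∩ ⋂ j, {q | k j + A j d < q.2 j}) := by
      ext q; simp [S]
    rw [this]
    refine isOpen_iUnion fun d => (isOpen_lt (by fun_prop) (by fun_prop)).inter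
      (isOpen_iInter_of_finite fun j => isOpen_lt (by fun_prop) (by fun_prop))
  have h0 : (0 : ℝ × (ι → ℝ)) ∉ S := by
    rintro ⟨d, hd, hd'⟩
    exact absurd (h d (by simpa using hd')) (not_le.2 (by simpa using hd))
  obtain ⟨f, hf⟩ := geometric_hahn_banach_open_point hSc hSo h0
  set l₀ : ℝ := -f (1, 0) with hl₀
  set l : ι → ℝ := fun j => -f (0, Pi.single j 1) with hl
  have hfe : ∀ r s, f (r, s) = -(l₀ * r + ∑ j, l j * s j) := by
    intro r s
    have e : (r, s) = r • ((1, 0) : ℝ × (ι → ℝ)) +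
        ∑ j, s j • ((0, Pi.single j 1) : ℝ × (ι → ℝ)) := by
      refine Prod.ext ?_ ?_
      · simp [Prod.fst_sum]
      · ext i
        simp [Prod.snd_sum, Finset.sum_apply, Pi.single_apply]
    rw [e, map_add, map_sum, map_smul]
    simp only [map_smul, smul_eq_mul, hl₀, hl, neg_mul, Finset.sum_neg_distrib, neg_add, neg_neg]
    simp only [mul_comm]
  have hpos : ∀ r s, (r, s) ∈ S → 0 < l₀ * r + ∑ j, l j * s j := by
    intro r s hrs
    have := hf _ hrs
    rw [hfe, map_zero] at this
    linarith
  -- Raising every coordinate by `t > 0` lands in `S`; letting `t` tend to zero gives the weak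
  -- inequality for non-strict bounds.
  have hcl : ∀ (d : E) (r : ℝ) (s : ι → ℝ), A₀ d ≤ r → (∀ j, k j + A j d ≤ s j) → 0 ≤ l₀ * r + ∑ j, l j * s j := by
    intro d r s hr hs
    have ht : Tendsto (fun t : ℝ => l₀ * (r + t) + ∑ j, l j * (s j + t)) (𝓝[>] 0)
        (𝓝 (l₀ * r + ∑ j, l j * s j)) := by
      have : Continuous fun t : ℝ => l₀ * (r + t) + ∑ j, l j * (s j + t) := by fun_prop
      simpa using (this.tendsto 0).mono_left nhdsWithin_le_nhds
    refine ge_of_tendsto ht ?_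
    filter_upwards [self_mem_nhdsWithin] with t (ht : 0 < t)
    exact (hpos (r + t) (fun j => s j + t)
      ⟨d, by simp only; linarith, fun j => by simp only; linarith [hs j]⟩).le
  have hl₀0 : 0 ≤ l₀ := by
    by_contra! hneg
    have hbd : ∀ t : ℝ, 0 ≤ t → 0 ≤ l₀ * t := by
      intro t ht
      have := hcl 0 t 0 (by simpa using ht) (by simpa using hk)
      simpa using this
    linarith [hbd 1 zero_le_one]
  have hl0 : ∀ j, 0 ≤ l j := by
    intro j
    have := hcl 0 0 (Pi.single j 1) (by simp) (fun i => by
      have := hk i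
      by_cases hij : i = j
      · subst hij; simp; linarith
      · simpa [hij] using this)
    simpa [Pi.single_apply] using this
  have hA : ∀ d, 0 ≤ l₀ * A₀ d + ∑ j, l j * (k j + A j d) := fun d =>
    hcl d _ _ le_rfl fun j => le_rfl
  have hcs : ∀ j, l j * k j = 0 := by
    have h1 : 0 ≤ ∑ j, l j * k j := by simpa using hA 0
    have h2 : ∀ j ∈ Finset.univ, l j * k j ≤ 0 := fun j _ =>
      mul_nonpos_of_nonneg_of_nonpos (hl0 j) (hk j)
    have h3 := (Finset.sum_eq_zero_iff_of_nonpos h2).1 (le_antisymm (Finset.sum_nonpos h2) h1)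
    exact fun j => h3 j (Finset.mem_univ j)
  -- If `l₀` vanished, the strict direction `d₀` would force every `l j` to vanish, contradicting
  -- strict positivity of the functional on `S`.
  have hl₀pos : 0 < l₀ := by
    refine lt_of_le_of_ne hl₀0 fun h00 => ?_
    have h1 := hA d₀
    have h2 : ∀ j ∈ Finset.univ, l j * (k j + A j d₀) ≤ 0 := fun j _ =>
      mul_nonpos_of_nonneg_of_nonpos (hl0 j) (hd₀ j).le
    rw [← h00, zero_mul, zero_add] at h1
    have h3 := (Finset.sum_eq_zero_iff_of_nonpos h2).1 (le_antisymm (Finset.sum_nonpos h2) h1)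
    have h4 : ∀ j, l j = 0 := fun j =>
      (mul_eq_zero.1 (h3 j (Finset.mem_univ j))).resolve_right (hd₀ j).ne
    have h5 := hpos (A₀ d₀ + 1) (fun j => 0) ⟨d₀, by simp, fun j => by simpa using hd₀ j⟩
    rw [← h00] at h5
    simp at h5
  have hA' : ∀ d, 0 ≤ l₀ * A₀ d + ∑ j, l j * A j d := by
    intro d
    have := hA d
    simpa [mul_add, Finset.sum_add_distrib, hcs] using this
  refine ⟨fun j => l j / l₀, fun j => div_nonneg (hl0 j) hl₀0, fun j => ?_, fun d => ?_⟩
  · rw [div_mul_eq_mul_div, hcs, zero_div]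
  -- A linear functional that is nonnegative at both `d` and `-d` vanishes.
  · have h1 := hA' d
    have h2 := hA' (-d)
    simp only [map_neg, mul_neg, Finset.sum_neg_distrib] at h2
    have h3 : l₀ * (A₀ d + ∑ j, l j / l₀ * A j d) = 0 := by
      rw [mul_add, Finset.mul_sum]
      have : ∀ j, l₀ * (l j / l₀ * A j d) = l j * A j d := fun j => by field_simp
      simp only [this]
      linarith
    exact (mul_eq_zero.1 h3).resolve_left hl₀pos.ne'

namespace OptProblem

variable {E ι : Type} [NormedAddCommGroup E] [NormedSpace ℝ E]

/-- A feasible point at which the linearized constraints are strictly feasible, and which is not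
worse than any strictly feasible point, is a KKT point. -/
lemma isKKT_of_forall_strictly_feasible [Fintype ι] {Q : OptProblem E ι} {x : E} (hx : Q.Feasible x)
    (hdom : Q.dom ∈ 𝓝 x) (hobj : DifferentiableAt ℝ Q.obj x)
    (hcon : ∀ j, DifferentiableAt ℝ (Q.con j) x)
    (d₀ : E) (hd₀ : ∀ j, Q.con j x + fderiv ℝ (Q.con j) x d₀ < 0)
    (hmin : ∀ x' ∈ Q.dom, (∀ j, Q.con j x' < 0) → Q.obj x ≤ Q.obj x') : Q.IsKKT x := by
  refine ⟨hx, hdom, hobj, hcon, ?_⟩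
  have hdir : ∀ d, (∀ j, Q.con j x + fderiv ℝ (Q.con j) x d < 0) → 0 ≤ fderiv ℝ Q.obj x d := by
    intro d hd
    refine fderiv_nonneg_of_eventually_le hobj ?_
    -- Active constraints decrease strictly along `d`; inactive ones stay negative by continuity.
    have hfeas : ∀ᶠ t : ℝ in 𝓝[>] 0, ∀ j, Q.con j (x + t • d) < 0 := by
      refine eventually_all.2 fun j => ?_
      rcases (hx.2 j).eq_or_lt with h0 | h0
      · have hj := hd j
        rw [h0, zero_add] at hj
        filter_upwards [eventually_lt_of_fderiv_neg (hcon j) hj] with t ht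
        rwa [h0] at ht
      · exact ((hcon j).continuousAt.tendsto.comp (tendsto_line x d)).eventually_lt_const h0
    filter_upwards [hfeas, (tendsto_line x d).eventually hdom] with t h1 h2
    exact hmin _ h2 h1
  obtain ⟨μ, h1, h2, h3⟩ := exists_multipliers (fderiv ℝ Q.obj x : E →ₗ[ℝ] ℝ)
    (fun j => (fderiv ℝ (Q.con j) x : E →ₗ[ℝ] ℝ)) (fun j => Q.con j x) hx.2 d₀ hd₀ hdir
  refine ⟨μ, h1, h2, ?_⟩
  ext d
  simpa using h3 d

/-- Slater's condition strictly satisfies the linearized constraints of a convex problem. -/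
lemma exists_linearized_lt_of_slater {Q : OptProblem E ι} (hQ : Q.Slater)
    (hconv : ∀ j, ConvexOn ℝ Q.dom (Q.con j)) {x : E} (hx : x ∈ Q.dom)
    (hcon : ∀ j, DifferentiableAt ℝ (Q.con j) x) :
    ∃ d, ∀ j, Q.con j x + fderiv ℝ (Q.con j) x d < 0 := by
  obtain ⟨x', hx', h⟩ := hQ
  exact ⟨x' - x, fun j =>
    (add_fderiv_le_of_convexOn (hconv j) hx hx' (hcon j)).trans_lt (h j)⟩

end OptProblem

end SecureSWIPT

namespace SecureSWIPT

variable {Ns Nr M : ℕ}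

/-! ### Gains and their linearizations -/

section Gains

variable (a : Fin Ns → ℂ)

lemma infoGain_nonneg (b : Beam Ns M) : 0 ≤ infoGain a b := by unfold infoGain; positivity

lemma energyGain_nonneg (b : Beam Ns M) : 0 ≤ energyGain a b := by unfold energyGain; positivity

/-- This is `0 ≤ ‖s - t‖ ^ 2` expanded; it makes every linearized gain a minorant. -/
lemma neg_sq_add_two_re_le (s t : ℂ) : -‖s‖ ^ 2 + 2 * (s * star t).re ≤ ‖t‖ ^ 2 := by
  rw [← Complex.normSq_eq_norm_sq, ← Complex.normSq_eq_norm_sq, Complex.normSq_apply,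
    Complex.normSq_apply]
  simp only [Complex.star_def, Complex.mul_re, Complex.conj_re, Complex.conj_im]
  nlinarith [sq_nonneg (s.re - t.re), sq_nonneg (s.im - t.im)]

lemma neg_sq_add_two_re_self (s : ℂ) : -‖s‖ ^ 2 + 2 * (s * star s).re = ‖s‖ ^ 2 := by
  rw [← Complex.normSq_eq_norm_sq, Complex.normSq_apply]
  simp only [Complex.star_def, Complex.mul_re, Complex.conj_re, Complex.conj_im]
  ring

lemma infoGainLin_le (f b : Beam Ns M) : infoGainLin a f b ≤ infoGain a b :=
  neg_sq_add_two_re_le _ _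

lemma infoGainLin_self (f : Beam Ns M) : infoGainLin a f f = infoGain a f :=
  neg_sq_add_two_re_self _

lemma energyGainLin_eq_sum (f b : Beam Ns M) :
    energyGainLin a f b =
      ∑ k, (-‖a ⬝ᵥ f.2 k‖ ^ 2 + 2 * ((a ⬝ᵥ f.2 k) * star (a ⬝ᵥ b.2 k)).re) := by
  rw [energyGainLin, energyGain, Finset.sum_add_distrib, Finset.sum_neg_distrib, Complex.re_sum,
    Finset.mul_sum]

lemma energyGainLin_le (f b : Beam Ns M) : energyGainLin a f b ≤ energyGain a b := by
  rw [energyGainLin_eq_sum]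
  exact Finset.sum_le_sum fun k _ => neg_sq_add_two_re_le _ _

lemma energyGainLin_self (f : Beam Ns M) : energyGainLin a f f = energyGain a f := by
  rw [energyGainLin_eq_sum]
  exact Finset.sum_congr rfl fun k _ => neg_sq_add_two_re_self _

lemma differentiable_infoGain : Differentiable ℝ (infoGain (M := M) a) := by
  have : Differentiable ℝ fun b : Beam Ns M => a ⬝ᵥ b.1 := by unfold dotProduct; fun_prop
  exact this.norm_sq ℝ

lemma differentiable_energyGain : Differentiable ℝ (energyGain (M := M) a) := by
  have : ∀ k, Differentiable ℝ fun b : Beam Ns M => a ⬝ᵥ b.2 k := fun k => by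
    unfold dotProduct; fun_prop
  exact Differentiable.fun_sum fun k _ => (this k).norm_sq ℝ

lemma differentiable_power : Differentiable ℝ (power (Ns := Ns) (M := M)) := by
  refine Differentiable.add (Differentiable.fun_sum fun n _ => ?_)
    (Differentiable.fun_sum fun k _ => Differentiable.fun_sum fun n _ => ?_)
  · exact Differentiable.norm_sq ℝ (by fun_prop)
  · exact Differentiable.norm_sq ℝ (by fun_prop)

lemma differentiable_re_mul_star (s : ℂ) {E : Type*} [NormedAddCommGroup E] [NormedSpace ℝ E]
    {g : E → ℂ} (hg : Differentiable ℝ g) : Differentiable ℝ fun x => (s * star (g x)).re := by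
  have h : Differentiable ℝ fun x => star (g x) := hg.star
  exact Complex.reCLM.differentiable.comp (h.const_mul s)

lemma differentiable_infoGainLin (f : Beam Ns M) : Differentiable ℝ (infoGainLin a f) := by
  have : Differentiable ℝ fun b : Beam Ns M => a ⬝ᵥ b.1 := by unfold dotProduct; fun_prop
  exact ((differentiable_re_mul_star _ this).const_mul 2).const_add _

lemma differentiable_energyGainLin (f : Beam Ns M) : Differentiable ℝ (energyGainLin a f) := by
  have : ∀ k, Differentiable ℝ fun b : Beam Ns M => a ⬝ᵥ b.2 k := fun k => by
    unfold dotProduct; fun_prop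
  rw [funext (energyGainLin_eq_sum a f)]
  exact Differentiable.fun_sum fun k _ =>
    ((differentiable_re_mul_star _ (this k)).const_mul 2).const_add _

/-- The variable here is the expansion point, which moves with the iterates when limits are taken.
-/
lemma continuous_infoGainLin_left (b : Beam Ns M) : Continuous fun f => infoGainLin a f b := by
  have : Continuous fun f : Beam Ns M => a ⬝ᵥ f.1 := by unfold dotProduct; fun_prop
  unfold infoGainLin infoGain
  fun_prop

lemma continuous_energyGainLin_left (b : Beam Ns M) :
    Continuous fun f => energyGainLin a f b := by
  have : ∀ k, Continuous fun f : Beam Ns M => a ⬝ᵥ f.2 k := fun k => by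
    unfold dotProduct; fun_prop
  unfold energyGainLin energyGain
  fun_prop

/-- The first-order expansion `s ↦ -‖s₀‖² + 2 Re (s₀ s̄)` along convex combinations. -/
lemma infoGainLin_combo (f b b' : Beam Ns M) {r t : ℝ} (h : r + t = 1) :
    infoGainLin a f (r • b + t • b') = r * infoGainLin a f b + t * infoGainLin a f b' := by
  have e : infoGain a f = r * infoGain a f + t * infoGain a f := by rw [← add_mul, h, one_mul]
  simp only [infoGainLin, Prod.fst_add, Prod.smul_fst, dotProduct_add, dotProduct_smul]
  simp only [star_add, mul_add, Complex.add_re, Complex.real_smul, star_mul', Complex.star_def,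
    Complex.conj_ofReal, mul_left_comm _ (Complex.ofReal _), Complex.re_ofReal_mul]
  linarith

lemma energyGainLin_combo (f b b' : Beam Ns M) {r t : ℝ} (h : r + t = 1) :
    energyGainLin a f (r • b + t • b') = r * energyGainLin a f b + t * energyGainLin a f b' := by
  have e : energyGain a f = r * energyGain a f + t * energyGain a f := by
    rw [← add_mul, h, one_mul]
  simp only [energyGainLin, Complex.re_sum, Prod.snd_add, Prod.smul_snd, Pi.add_apply,
    Pi.smul_apply, dotProduct_add, dotProduct_smul]
  simp only [star_add, mul_add, Complex.add_re, Complex.real_smul, star_mul', Complex.star_def,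
    Complex.conj_ofReal, mul_left_comm _ (Complex.ofReal _), Complex.re_ofReal_mul,
    Finset.sum_add_distrib, ← Finset.mul_sum]
  linarith

lemma convexOn_power : ConvexOn ℝ Set.univ (power (Ns := Ns) (M := M)) := by
  have hsq : ∀ s t : ℂ, ∀ α β : ℝ, 0 ≤ α → 0 ≤ β → α + β = 1 →
      ‖α • s + β • t‖ ^ 2 ≤ α * ‖s‖ ^ 2 + β * ‖t‖ ^ 2 := by
    intro s t α β hα hβ hαβ
    have := ((convexOn_norm (E := ℂ) convex_univ).pow (fun _ _ => norm_nonneg _) 2).2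
      (Set.mem_univ s) (Set.mem_univ t) hα hβ hαβ
    simpa using this
  refine ⟨convex_univ, fun b _ b' _ α β hα hβ hαβ => ?_⟩
  simp only [power, smul_eq_mul, mul_add, Finset.mul_sum]
  rw [add_add_add_comm, ← Finset.sum_add_distrib, ← Finset.sum_add_distrib]
  simp only [← Finset.sum_add_distrib]
  exact add_le_add (Finset.sum_le_sum fun n _ => hsq _ _ _ _ hα hβ hαβ)
    (Finset.sum_le_sum fun k _ => Finset.sum_le_sum fun n _ => hsq _ _ _ _ hα hβ hαβ)

/-- Joint convexity of the quadratic-over-linear function. -/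
lemma norm_sq_div_combo_le (s t : ℂ) {d e α β : ℝ} (hd : 0 < d) (he : 0 < e) (hα : 0 ≤ α)
    (hβ : 0 ≤ β) (hαβ : α + β = 1) :
    ‖α • s + β • t‖ ^ 2 / (α * d + β * e) ≤ α * (‖s‖ ^ 2 / d) + β * (‖t‖ ^ 2 / e) := by
  have hpos : 0 < α * d + β * e := by
    rcases hα.eq_or_lt with rfl | hα
    · obtain rfl : β = 1 := by linarith
      simpa using he
    · positivity
  have hn : ‖α • s + β • t‖ ≤ α * ‖s‖ + β * ‖t‖ := by
    refine (norm_add_le _ _).trans_eq ?_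
    rw [norm_smul, norm_smul, Real.norm_of_nonneg hα, Real.norm_of_nonneg hβ]
  have hn2 : ‖α • s + β • t‖ ^ 2 ≤ (α * ‖s‖ + β * ‖t‖) ^ 2 := by gcongr
  rw [div_le_iff₀ hpos]
  refine hn2.trans (sub_nonneg.1 ?_)
  -- The defect in this Cauchy–Schwarz inequality is an explicit square.
  have : (α * (‖s‖ ^ 2 / d) + β * (‖t‖ ^ 2 / e)) * (α * d + β * e) - (α * ‖s‖ + β * ‖t‖) ^ 2
      = α * β * (‖s‖ * e - ‖t‖ * d) ^ 2 / (d * e) := by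
    field_simp
    ring
  rw [this]
  positivity

end Gains

/-! ### The block problems -/

lemma differentiableAt_div {E : Type*} [NormedAddCommGroup E] [NormedSpace ℝ E] {f g : E → ℝ}
    {x : E} (hf : DifferentiableAt ℝ f x) (hg : DifferentiableAt ℝ g x) (h : g x ≠ 0) :
    DifferentiableAt ℝ (fun x => f x / g x) x := by
  simp only [div_eq_mul_inv]
  exact hf.mul (hg.inv h)

section Problems

variable (H : Channels Ns Nr M) (θ : Fin Nr → ℝ) (c : Params M)

lemma energyGain_add_sq_pos (a : Fin Ns → ℂ) {σ : ℝ} (hσ : 0 < σ) (b : Beam Ns M) :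
    0 < energyGain a b + σ ^ 2 := by
  have := energyGain_nonneg a b
  positivity

variable {H θ c}

lemma sinrI_nonneg (hσI : 0 < c.σI) (b : Beam Ns M) : 0 ≤ sinrI H θ c b :=
  div_nonneg (infoGain_nonneg _ _) (energyGain_add_sq_pos _ hσI b).le

lemma sinrE_nonneg (hσE : ∀ m, 0 < c.σE m) (m : Fin M) (b : Beam Ns M) : 0 ≤ sinrE H θ c m b :=
  div_nonneg (infoGain_nonneg _ _) (energyGain_add_sq_pos _ (hσE m) b).le

lemma differentiable_sinrI (hσI : 0 < c.σI) : Differentiable ℝ (sinrI H θ c) :=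
  fun b => differentiableAt_div (differentiable_infoGain _ b)
    ((differentiable_energyGain _).add_const _ b) (energyGain_add_sq_pos _ hσI b).ne'

lemma differentiable_sinrE (hσE : ∀ m, 0 < c.σE m) (m : Fin M) :
    Differentiable ℝ (sinrE H θ c m) :=
  fun b => differentiableAt_div (differentiable_infoGain _ b)
    ((differentiable_energyGain _).add_const _ b) (energyGain_add_sq_pos _ (hσE m) b).ne'

lemma differentiable_rfPower (m : Fin M) : Differentiable ℝ (rfPower H θ m) :=
  (differentiable_infoGain _).add (differentiable_energyGain _)

/-- The optimal receiver `u` for the beams `b`. -/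
noncomputable def receiver (H : Channels Ns Nr M) (θ : Fin Nr → ℝ) (c : Params M)
    (b : Beam Ns M) : ℂ :=
  (hEff H θ ⬝ᵥ b.1) /
    ((infoGain (hEff H θ) b + (energyGain (hEff H θ) b + c.σI ^ 2) : ℝ) : ℂ)

/-- Completing the square in `u`: the leading coefficient is the total received power plus noise,
and the remainder is one minus the signal's share of it. The minimum and its uniqueness can be read
off. -/
lemma mse_eq (hσI : 0 < c.σI) (b : Beam Ns M) (u : ℂ) :
    mse H θ c b u =
      (infoGain (hEff H θ) b + (energyGain (hEff H θ) b + c.σI ^ 2)) *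
        ‖u - receiver H θ c b‖ ^ 2 + (1 + sinrI H θ c b)⁻¹ := by
  have hE := energyGain_add_sq_pos (hEff H θ) hσI b
  have hI := infoGain_nonneg (hEff H θ) b
  set D := energyGain (hEff H θ) b + c.σI ^ 2 with hD
  set s := hEff H θ ⬝ᵥ b.1 with hs
  have hIs : infoGain (hEff H θ) b = s.re * s.re + s.im * s.im := by
    rw [← Complex.normSq_apply, Complex.normSq_eq_norm_sq, hs, infoGain]
  have e1 : (1 + sinrI H θ c b)⁻¹ = 1 - infoGain (hEff H θ) b / (infoGain (hEff H θ) b + D) := by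
    rw [sinrI, ← hD]
    field_simp
    ring
  have e2 : mse H θ c b u =
      ‖u‖ ^ 2 * (infoGain (hEff H θ) b + D) + 1 - 2 * (star u * s).re := by
    rw [mse, hD]; ring
  rw [e1, e2, receiver, ← hD, ← hs, ← Complex.normSq_eq_norm_sq, ← Complex.normSq_eq_norm_sq,
    Complex.normSq_apply, Complex.normSq_apply]
  have hT : 0 < infoGain (hEff H θ) b + D := by linarith
  simp only [Complex.star_def, Complex.mul_re, Complex.conj_re, Complex.conj_im, Complex.sub_re,
    Complex.sub_im, Complex.div_ofReal_re, Complex.div_ofReal_im]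
  set T := infoGain (hEff H θ) b + D with hT'
  rw [hIs]
  field_simp
  ring

lemma inv_le_mse (hσI : 0 < c.σI) (b : Beam Ns M) (u : ℂ) :
    (1 + sinrI H θ c b)⁻¹ ≤ mse H θ c b u := by
  rw [mse_eq hσI]
  have := energyGain_add_sq_pos (hEff H θ) hσI b
  have := infoGain_nonneg (hEff H θ) b
  have : 0 ≤ (infoGain (hEff H θ) b + (energyGain (hEff H θ) b + c.σI ^ 2)) *
        ‖u - receiver H θ c b‖ ^ 2 := by positivity
  linarith

lemma mse_pos (hσI : 0 < c.σI) (b : Beam Ns M) (u : ℂ) : 0 < mse H θ c b u :=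
  lt_of_lt_of_le (by have := sinrI_nonneg (H := H) (θ := θ) hσI b; positivity) (inv_le_mse hσI b u)

lemma mse_receiver (hσI : 0 < c.σI) (b : Beam Ns M) :
    mse H θ c b (receiver H θ c b) = (1 + sinrI H θ c b)⁻¹ := by
  rw [mse_eq hσI]; simp

lemma eq_receiver_of_mse_le (hσI : 0 < c.σI) {b : Beam Ns M} {u : ℂ}
    (h : mse H θ c b u ≤ (1 + sinrI H θ c b)⁻¹) : u = receiver H θ c b := by
  rw [mse_eq hσI] at h
  have h1 := energyGain_add_sq_pos (hEff H θ) hσI b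
  have h2 := infoGain_nonneg (hEff H θ) b
  have h3 : 0 < infoGain (hEff H θ) b + (energyGain (hEff H θ) b + c.σI ^ 2) := by linarith
  have h4 : ‖u - receiver H θ c b‖ ^ 2 ≤ 0 := by
    by_contra! h5
    have := mul_pos h3 h5
    linarith
  have h5 : ‖u - receiver H θ c b‖ = 0 := by
    have := norm_nonneg (u - receiver H θ c b)
    nlinarith
  exact sub_eq_zero.1 (norm_eq_zero.1 h5)

lemma continuous_receiver (hσI : 0 < c.σI) : Continuous (receiver H θ c) := by
  have h1 : Continuous fun b : Beam Ns M => hEff H θ ⬝ᵥ b.1 := by unfold dotProduct; fun_prop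
  have h2 := (differentiable_infoGain (M := M) (hEff H θ)).continuous
  have h3 := (differentiable_energyGain (M := M) (hEff H θ)).continuous
  refine h1.div (Complex.continuous_ofReal.comp (h2.add (h3.add continuous_const))) fun b => ?_
  have h1 := energyGain_add_sq_pos (hEff H θ) hσI b
  have h2 := infoGain_nonneg (hEff H θ) b
  exact Complex.ofReal_ne_zero.2 (by linarith)

lemma differentiable_mse : Differentiable ℝ fun q : Beam Ns M × ℂ => mse H θ c q.1 q.2 := by
  have h1 : Differentiable ℝ fun q : Beam Ns M × ℂ => infoGain (hEff H θ) q.1 :=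
    (differentiable_infoGain _).comp differentiable_fst
  have h2 : Differentiable ℝ fun q : Beam Ns M × ℂ => energyGain (hEff H θ) q.1 :=
    (differentiable_energyGain _).comp differentiable_fst
  have h3 : Differentiable ℝ fun q : Beam Ns M × ℂ => ‖q.2‖ ^ 2 := differentiable_snd.norm_sq ℝ
  have h4 : Differentiable ℝ fun q : Beam Ns M × ℂ => (star q.2 * (hEff H θ ⬝ᵥ q.1.1)).re := by
    have h5 : Differentiable ℝ fun q : Beam Ns M × ℂ => hEff H θ ⬝ᵥ q.1.1 := by
      unfold dotProduct; fun_prop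
    have h6 : Differentiable ℝ fun q : Beam Ns M × ℂ => star q.2 := differentiable_snd.star
    exact Complex.reCLM.differentiable.comp (h6.mul h5)
  unfold mse
  fun_prop

/-- The expansions are affine in the beams. Hence the domain is an intersection of open half-spaces,
the SINR constraints are quadratic-over-affine, the harvesting constraints are affine, and the power
is a convex quadratic. -/
lemma convexOn_step3_con (f : Beam Ns M) (z : ℝ) (u : ℂ) (v : ℝ) (j : Fin M ⊕ Fin M ⊕ Unit) :
    ConvexOn ℝ (step3 H θ c f z u v).dom ((step3 H θ c f z u v).con j) := by
  have hden : ∀ m b b', ∀ r t : ℝ, r + t = 1 → denLin H θ c f m (r • b + t • b') =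
      r * denLin H θ c f m b + t * denLin H θ c f m b' := by
    intro m b b' r t h
    have e : c.σE m ^ 2 = r * c.σE m ^ 2 + t * c.σE m ^ 2 := by rw [← add_mul, h, one_mul]
    rw [denLin, energyGainLin_combo _ _ _ _ h, denLin, denLin]
    linarith
  have hdom : Convex ℝ (step3 H θ c f z u v).dom := by
    intro q hq q' hq' r t hr ht hrt m
    change 0 < denLin H θ c f m (r • q.1 + t • q'.1)
    rw [hden m _ _ _ _ hrt]
    have h1 := hq m
    have h2 := hq' m
    rcases hr.eq_or_lt with rfl | hr
    · obtain rfl : t = 1 := by linarith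
      simpa using h2
    · positivity
  refine ⟨hdom, fun q hq q' hq' r t hr ht hrt => ?_⟩
  rcases j with m | m | _
  · change infoGain (gEff H θ m) (r • q.1 + t • q'.1) / denLin H θ c f m (r • q.1 + t • q'.1) -
      (r * q.2 m + t * q'.2 m) ≤
      r * (infoGain (gEff H θ m) q.1 / denLin H θ c f m q.1 - q.2 m) +
      t * (infoGain (gEff H θ m) q'.1 / denLin H θ c f m q'.1 - q'.2 m)
    rw [hden m _ _ _ _ hrt]
    have h := norm_sq_div_combo_le (gEff H θ m ⬝ᵥ q.1.1) (gEff H θ m ⬝ᵥ q'.1.1)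
      (hq m) (hq' m) hr ht hrt
    have e : infoGain (gEff H θ m) (r • q.1 + t • q'.1) =
        ‖r • (gEff H θ m ⬝ᵥ q.1.1) + t • (gEff H θ m ⬝ᵥ q'.1.1)‖ ^ 2 := by
      simp only [infoGain, Prod.fst_add, Prod.smul_fst, dotProduct_add, dotProduct_smul]
    rw [e]
    simp only [infoGain] at *
    linarith
  · change c.ε m - (infoGainLin (gEff H θ m) f (r • q.1 + t • q'.1) +
        energyGainLin (gEff H θ m) f (r • q.1 + t • q'.1)) ≤
      r * (c.ε m - (infoGainLin (gEff H θ m) f q.1 + energyGainLin (gEff H θ m) f q.1)) +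
      t * (c.ε m - (infoGainLin (gEff H θ m) f q'.1 + energyGainLin (gEff H θ m) f q'.1))
    rw [infoGainLin_combo _ _ _ _ hrt, energyGainLin_combo _ _ _ _ hrt]
    have e : c.ε m = r * c.ε m + t * c.ε m := by rw [← add_mul, hrt, one_mul]
    linarith
  · change power (r • q.1 + t • q'.1) - c.Pt ≤ r * (power q.1 - c.Pt) + t * (power q'.1 - c.Pt)
    have h := convexOn_power.2 (Set.mem_univ q.1) (Set.mem_univ q'.1) hr ht hrt
    have e : c.Pt = r * c.Pt + t * c.Pt := by rw [← add_mul, hrt, one_mul]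
    simp only [smul_eq_mul] at h
    linarith

end Problems

end SecureSWIPT

namespace SecureSWIPT

variable {Ns Nr M : ℕ} {H : Channels Ns Nr M} {θ : Fin Nr → ℝ} {c : Params M}

/-! ### The surrogate objective -/

/-- This is `log t ≤ t - 1` at `t = z * e`; its strict form for `t ≠ 1` gives the uniqueness lemma
that follows. -/
lemma one_add_log_le_mul_sub_log {z e : ℝ} (hz : 0 < z) (he : 0 < e) :
    1 + Real.log e ≤ z * e - Real.log z := by
  have := Real.log_le_sub_one_of_pos (mul_pos hz he)
  rw [Real.log_mul hz.ne' he.ne'] at this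
  linarith

lemma eq_inv_of_mul_sub_log_le {z e : ℝ} (hz : 0 < z) (he : 0 < e)
    (h : z * e - Real.log z ≤ 1 + Real.log e) : z = e⁻¹ := by
  by_contra hne
  have := Real.log_lt_sub_one_of_pos (mul_pos hz he) fun h1 => hne (eq_inv_of_mul_eq_one_left h1)
  rw [Real.log_mul hz.ne' he.ne'] at this
  linarith

/-- At least one energy user is needed here: for an empty sum the surrogate would be unbounded below
in `v`. -/
lemma sum_rpow_pos (hM : 0 < M) {y : Fin M → ℝ} (hy : ∀ m, 0 ≤ y m) (p : ℝ) :
    0 < ∑ m, (1 + y m) ^ p :=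
  Finset.sum_pos (fun m _ => Real.rpow_pos_of_pos (by linarith [hy m]) _)
    ⟨⟨0, hM⟩, Finset.mem_univ _⟩

/-- Grouped this way, the surrogate separates in `z` and `v` into two problems of the same form `t *
s - log t`. -/
lemma surrogate_apply (b : Beam Ns M) (z : ℝ) (u : ℂ) (v : ℝ) (y : Fin M → ℝ) :
    surrogate H θ c (b, z, u, v, y) = (z * mse H θ c b u - Real.log z) +
      1 / c.p * (v * (∑ m, (1 + y m) ^ c.p) - Real.log v) := by
  rw [surrogate]; ring

lemma le_surrogate (hp : 0 < c.p) {b : Beam Ns M} {z : ℝ} {u : ℂ} {v : ℝ} {y : Fin M → ℝ}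
    (he : 0 < mse H θ c b u) (hS : 0 < ∑ m, (1 + y m) ^ c.p) (hz : 0 < z) (hv : 0 < v) :
    (1 + Real.log (mse H θ c b u)) + 1 / c.p * (1 + Real.log (∑ m, (1 + y m) ^ c.p)) ≤
      surrogate H θ c (b, z, u, v, y) := by
  rw [surrogate_apply]
  have h1 := one_add_log_le_mul_sub_log hz he
  have h2 := one_add_log_le_mul_sub_log hv hS
  gcongr

lemma surrogate_inv {b : Beam Ns M} {u : ℂ} {y : Fin M → ℝ}
    (he : 0 < mse H θ c b u) (hS : 0 < ∑ m, (1 + y m) ^ c.p) :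
    surrogate H θ c (b, (mse H θ c b u)⁻¹, u, (∑ m, (1 + y m) ^ c.p)⁻¹, y) =
    (1 + Real.log (mse H θ c b u)) + 1 / c.p * (1 + Real.log (∑ m, (1 + y m) ^ c.p)) := by
  rw [surrogate_apply, inv_mul_cancel₀ he.ne', inv_mul_cancel₀ hS.ne', Real.log_inv, Real.log_inv]
  ring

/-- Uniqueness of the solution of the first block problem. -/
lemma eq_inv_of_surrogate_le (hp : 0 < c.p) {b : Beam Ns M} {z : ℝ} {u : ℂ} {v : ℝ}
    {y : Fin M → ℝ} (he : 0 < mse H θ c b u) (hS : 0 < ∑ m, (1 + y m) ^ c.p) (hz : 0 < z)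
    (hv : 0 < v) (h : surrogate H θ c (b, z, u, v, y) ≤
      surrogate H θ c (b, (mse H θ c b u)⁻¹, u, (∑ m, (1 + y m) ^ c.p)⁻¹, y)) :
    z = (mse H θ c b u)⁻¹ ∧ v = (∑ m, (1 + y m) ^ c.p)⁻¹ := by
  rw [surrogate_inv he hS, surrogate_apply] at h
  have h1 := one_add_log_le_mul_sub_log hz he
  have h2 := one_add_log_le_mul_sub_log hv hS
  have hp' : 0 < 1 / c.p := by positivity
  have h3 := mul_le_mul_of_nonneg_left h2 hp'.le
  exact ⟨eq_inv_of_mul_sub_log_le hz he (by linarith),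
    eq_inv_of_mul_sub_log_le hv hS (le_of_mul_le_mul_left (by linarith) hp')⟩

lemma step1_minimizer_eq (hp : 0 < c.p) {b : Beam Ns M} {z : ℝ} {u : ℂ} {v : ℝ} {y : Fin M → ℝ}
    (he : 0 < mse H θ c b u) (hS : 0 < ∑ m, (1 + y m) ^ c.p)
    (h : (step1 H θ c b u y).IsMinimizer (z, v)) :
    z = (mse H θ c b u)⁻¹ ∧ v = (∑ m, (1 + y m) ^ c.p)⁻¹ :=
  eq_inv_of_surrogate_le hp he hS h.1.1.1 h.1.1.2
    (h.2 (_, _) ⟨⟨inv_pos.2 he, inv_pos.2 hS⟩, fun j => j.elim⟩)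

lemma step2_minimizer_eq (hσI : 0 < c.σI) {b : Beam Ns M} {u : ℂ}
    (h : (step2 H θ c b).IsMinimizer u) : u = receiver H θ c b :=
  eq_receiver_of_mse_le hσI <|
    (h.2 (receiver H θ c b) ⟨Set.mem_univ _, fun j => j.elim⟩).trans_eq (mse_receiver hσI b)

lemma differentiableAt_surrogate {b : Beam Ns M} {z : ℝ} {u : ℂ} {v : ℝ} {y : Fin M → ℝ}
    (hz : 0 < z) (hv : 0 < v) (hy : ∀ m, 0 ≤ y m) :
    DifferentiableAt ℝ (surrogate H θ c) (b, z, u, v, y) := by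
  have h1 : DifferentiableAt ℝ (fun x : Vars Ns M => mse H θ c x.1 x.2.2.1) (b, z, u, v, y) := by
    have h : Differentiable ℝ fun x : Vars Ns M => ((x.1, x.2.2.1) : Beam Ns M × ℂ) := by fun_prop
    exact (differentiable_mse.comp h) _
  have h2 : DifferentiableAt ℝ (fun x : Vars Ns M => Real.log x.2.1) (b, z, u, v, y) :=
    DifferentiableAt.log (by fun_prop) hz.ne'
  have h3 : DifferentiableAt ℝ (fun x : Vars Ns M => Real.log x.2.2.2.1) (b, z, u, v, y) :=
    DifferentiableAt.log (by fun_prop) hv.ne'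
  have h4 : ∀ m, DifferentiableAt ℝ (fun x : Vars Ns M => (1 + x.2.2.2.2 m) ^ c.p)
      (b, z, u, v, y) := fun m =>
    DifferentiableAt.rpow_const (by fun_prop)
      (Or.inl (show 1 + y m ≠ 0 by linarith [hy m]))
  have e : surrogate H θ c = fun x => x.2.1 * mse H θ c x.1 x.2.2.1 - Real.log x.2.1 +
      1 / c.p * x.2.2.2.1 * (∑ m, (1 + x.2.2.2.2 m) ^ c.p) - 1 / c.p * Real.log x.2.2.2.1 := rfl
  rw [e]
  fun_prop

/-! ### Feasibility and descent -/

lemma reformulated_feasible_iff {x : Vars Ns M} : (reformulated H θ c).Feasible x ↔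
    (0 < x.2.1 ∧ 0 < x.2.2.2.1) ∧ (∀ m, sinrE H θ c m x.1 ≤ x.2.2.2.2 m) ∧
      (∀ m, c.ε m ≤ rfPower H θ m x.1) ∧ power x.1 ≤ c.Pt := by
  simp [OptProblem.Feasible, reformulated]

lemma denLin_self (f : Beam Ns M) (m : Fin M) :
    denLin H θ c f m f = energyGain (gEff H θ m) f + c.σE m ^ 2 := by
  rw [denLin, energyGainLin_self]

/-- Linearizing the energy gain only shrinks the denominator. -/
lemma sinrE_le_div_denLin {f b : Beam Ns M} {m : Fin M} (h : 0 < denLin H θ c f m b) :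
    sinrE H θ c m b ≤ infoGain (gEff H θ m) b / denLin H θ c f m b :=
  div_le_div_of_nonneg_left (infoGain_nonneg _ _) h
    (add_le_add_left (energyGainLin_le _ _ _) _)

/-- The constraints of the reformulated problem, in the variables of the third block. -/
noncomputable def blockCon (H : Channels Ns Nr M) (θ : Fin Nr → ℝ) (c : Params M) :
    Fin M ⊕ Fin M ⊕ Unit → Beam Ns M × (Fin M → ℝ) → ℝ
  | .inl m => fun q => sinrE H θ c m q.1 - q.2 m
  | .inr (.inl m) => fun q => c.ε m - rfPower H θ m q.1
  | .inr (.inr _) => fun q => power q.1 - c.Pt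

lemma reformulated_con (j : Fin M ⊕ Fin M ⊕ Unit) (x : Vars Ns M) :
    (reformulated H θ c).con j x = blockCon H θ c j (x.1, x.2.2.2.2) := by
  rcases j with m | m | _ <;> rfl

/-- The convexified constraints majorize the original ones. -/
lemma blockCon_le_step3_con {f : Beam Ns M} {z : ℝ} {u : ℂ} {v : ℝ}
    {q : Beam Ns M × (Fin M → ℝ)} (hq : q ∈ (step3 H θ c f z u v).dom)
    (j : Fin M ⊕ Fin M ⊕ Unit) : blockCon H θ c j q ≤ (step3 H θ c f z u v).con j q := by
  rcases j with m | m | _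
  · exact sub_le_sub_right (sinrE_le_div_denLin (hq m)) _
  · exact sub_le_sub_left (add_le_add (infoGainLin_le _ _ _) (energyGainLin_le _ _ _)) _
  · exact le_rfl

lemma step3_con_self (b : Beam Ns M) (z : ℝ) (u : ℂ) (v : ℝ) (y : Fin M → ℝ)
    (j : Fin M ⊕ Fin M ⊕ Unit) :
    (step3 H θ c b z u v).con j (b, y) = blockCon H θ c j (b, y) := by
  rcases j with m | m | _
  · simp [step3, blockCon, denLin_self, sinrE]
  · simp [step3, blockCon, infoGainLin_self, energyGainLin_self, rfPower]
  · rfl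

lemma mem_step3_dom_self (hσE : ∀ m, 0 < c.σE m) (b : Beam Ns M) (z : ℝ) (u : ℂ) (v : ℝ)
    (y : Fin M → ℝ) : (b, y) ∈ (step3 H θ c b z u v).dom := fun m => by
  rw [denLin_self]
  exact energyGain_add_sq_pos _ (hσE m) b

/-- The expansions are exact at the expansion point, so the old beams and `y` stay admissible
whatever `z`, `u`, `v` have become. Descent in the third block rests on this. -/
lemma step3_feasible_self (hσE : ∀ m, 0 < c.σE m) {b : Beam Ns M} {z : ℝ} {u : ℂ} {v : ℝ}
    {y : Fin M → ℝ} (h : (reformulated H θ c).Feasible (b, z, u, v, y)) (z' : ℝ) (u' : ℂ)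
    (v' : ℝ) : (step3 H θ c b z' u' v').Feasible (b, y) :=
  ⟨mem_step3_dom_self hσE b z' u' v' y, fun j => by
    rw [step3_con_self]
    exact (reformulated_con j _).symm.trans_le (h.2 j)⟩

lemma isIteration_iff {x x' : Vars Ns M} : IsIteration H θ c x x' ↔
    (step1 H θ c x.1 x.2.2.1 x.2.2.2.2).IsMinimizer (x'.2.1, x'.2.2.2.1) ∧
    (step2 H θ c x.1).IsMinimizer x'.2.2.1 ∧
    (step3 H θ c x.1 x'.2.1 x'.2.2.1 x'.2.2.2.1).IsMinimizer (x'.1, x'.2.2.2.2) := Iff.rfl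

/-- The convexified feasible set is an inner approximation of the true one, so the previous iterate
need not be feasible. -/
lemma feasible_of_isIteration {x x' : Vars Ns M} (h : IsIteration H θ c x x') :
    (reformulated H θ c).Feasible x' := by
  obtain ⟨h1, -, h3⟩ := isIteration_iff.1 h
  refine ⟨h1.1.1, fun j => ?_⟩
  rw [reformulated_con]
  exact (blockCon_le_step3_con h3.1.1 j).trans (h3.1.2 j)

/-- Descent in the first two blocks. -/
lemma surrogate_blocks_le {x x' : Vars Ns M} (hx : (reformulated H θ c).Feasible x)
    (h : IsIteration H θ c x x') :
    surrogate H θ c (x.1, x'.2.1, x'.2.2.1, x'.2.2.2.1, x.2.2.2.2) ≤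
      surrogate H θ c (x.1, x'.2.1, x.2.2.1, x'.2.2.2.1, x.2.2.2.2) ∧
    surrogate H θ c (x.1, x'.2.1, x.2.2.1, x'.2.2.2.1, x.2.2.2.2) ≤ surrogate H θ c x := by
  obtain ⟨h1, h2, -⟩ := isIteration_iff.1 h
  refine ⟨?_, h1.2 (x.2.1, x.2.2.2.1) ⟨hx.1, fun j => j.elim⟩⟩
  rw [surrogate_apply, surrogate_apply]
  have := mul_le_mul_of_nonneg_left (h2.2 x.2.2.1 ⟨Set.mem_univ _, fun j => j.elim⟩) h1.1.1.1.le
  simp only [step2] at this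
  linarith

lemma surrogate_le_of_isIteration (hσE : ∀ m, 0 < c.σE m) {x x' : Vars Ns M}
    (hx : (reformulated H θ c).Feasible x) (h : IsIteration H θ c x x') :
    surrogate H θ c x' ≤
      surrogate H θ c (x.1, x'.2.1, x'.2.2.1, x'.2.2.2.1, x.2.2.2.2) :=
  (isIteration_iff.1 h).2.2.2 (x.1, x.2.2.2.2) (step3_feasible_self hσE hx _ _ _)

lemma feasible_of_isRun {x : ℕ → Vars Ns M} (hx : IsRun H θ c x) (i : ℕ) :
    (reformulated H θ c).Feasible (x i) := by
  cases i with
  | zero => exact hx.1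
  | succ i => exact feasible_of_isIteration (hx.2 i)

lemma antitone_surrogate (hσE : ∀ m, 0 < c.σE m) {x : ℕ → Vars Ns M} (hx : IsRun H θ c x) :
    Antitone fun i => surrogate H θ c (x i) :=
  antitone_nat_of_succ_le fun i =>
    have h := surrogate_blocks_le (feasible_of_isRun hx i) (hx.2 i)
    (surrogate_le_of_isIteration hσE (feasible_of_isRun hx i) (hx.2 i)).trans (h.1.trans h.2)

/-! ### Limit points -/

/-- As `log t ≤ t - 1` and `t` converges, `log s` is bounded below, and `s` stays above an
exponential with positive limit. -/
lemma pos_of_tendsto_of_le_log {α β C a b : ℝ} {s t : ℕ → ℝ} (hα : 0 < α) (hβ : 0 < β)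
    (hs : ∀ k, 0 < s k) (ht : ∀ k, 0 < t k) (hsa : Tendsto s atTop (𝓝 a))
    (htb : Tendsto t atTop (𝓝 b)) (h : ∀ k, C ≤ α * Real.log (s k) + β * Real.log (t k)) :
    0 < a := by
  refine (Real.exp_pos ((C - β * b) / α)).trans_le ?_
  have hl : Tendsto (fun k => Real.exp ((C - β * t k) / α)) atTop
      (𝓝 (Real.exp ((C - β * b) / α))) :=
    (Real.continuous_exp.tendsto _).comp (((htb.const_mul β).const_sub C).div_const α)
  refine le_of_tendsto_of_tendsto' hl hsa fun k => ?_
  rw [← Real.le_log_iff_exp_le (hs k), div_le_iff₀ hα]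
  have h1 := mul_le_mul_of_nonneg_left (Real.log_le_sub_one_of_pos (ht k)) hβ.le
  have h2 := h k
  nlinarith

/-- Dropping the nonnegative terms leaves the logarithmic barrier. Since the surrogate is bounded
above along a run, it keeps `z` and `v` from tending to zero. -/
lemma neg_log_le_surrogate (hσI : 0 < c.σI) (hσE : ∀ m, 0 < c.σE m) (hp : 0 < c.p)
    {x : Vars Ns M} (hx : (reformulated H θ c).Feasible x) :
    -surrogate H θ c x ≤ 1 * Real.log x.2.1 + 1 / c.p * Real.log x.2.2.2.1 := by
  obtain ⟨⟨hz, hv⟩, hy, -⟩ := reformulated_feasible_iff.1 hx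
  have h1 := mul_pos hz (mse_pos (H := H) (θ := θ) hσI x.1 x.2.2.1)
  have h2 : 0 ≤ 1 / c.p * (x.2.2.2.1 * ∑ m, (1 + x.2.2.2.2 m) ^ c.p) := by
    refine mul_nonneg (by positivity) (mul_nonneg hv.le (Finset.sum_nonneg fun m _ => ?_))
    have := (sinrE_nonneg hσE m x.1).trans (hy m)
    positivity
  have h3 : surrogate H θ c x = _ :=
    surrogate_apply (H := H) (θ := θ) (c := c) x.1 x.2.1 x.2.2.1 x.2.2.2.1 x.2.2.2.2
  rw [h3]
  linarith

lemma feasible_of_isLimitPoint (hσI : 0 < c.σI) (hσE : ∀ m, 0 < c.σE m) (hp : 0 < c.p)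
    {x : ℕ → Vars Ns M} (hx : IsRun H θ c x) {x' : Vars Ns M} (hlim : IsLimitPoint x x') :
    (reformulated H θ c).Feasible x' := by
  obtain ⟨φ, -, hφ⟩ := hlim
  have hf := fun k => reformulated_feasible_iff.1 (feasible_of_isRun hx (φ k))
  have hlog : ∀ k, -surrogate H θ c (x 0) ≤
      1 * Real.log (x (φ k)).2.1 + 1 / c.p * Real.log (x (φ k)).2.2.2.1 := fun k =>
    (neg_le_neg (antitone_surrogate hσE hx (Nat.zero_le (φ k)))).trans
      (neg_log_le_surrogate hσI hσE hp (feasible_of_isRun hx (φ k)))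
  have hlim : ∀ {g : Vars Ns M → ℝ}, Continuous g →
      Tendsto (fun k => g (x (φ k))) atTop (𝓝 (g x')) := fun hg => (hg.tendsto x').comp hφ
  have hz := hlim (g := fun x => x.2.1) (by fun_prop)
  have hv := hlim (g := fun x => x.2.2.2.1) (by fun_prop)
  have hp' : 0 < 1 / c.p := by positivity
  refine reformulated_feasible_iff.2 ⟨⟨?_, ?_⟩, fun m => ?_, fun m => ?_, ?_⟩
  · exact pos_of_tendsto_of_le_log one_pos hp' (fun k => (hf k).1.1) (fun k => (hf k).1.2) hz hv
      hlog
  · exact pos_of_tendsto_of_le_log hp' one_pos (fun k => (hf k).1.2) (fun k => (hf k).1.1) hv hz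
      fun k => (hlog k).trans_eq (add_comm _ _)
  · exact le_of_tendsto_of_tendsto'
      (hlim ((differentiable_sinrE hσE m).continuous.comp continuous_fst))
      (hlim (g := fun x => x.2.2.2.2 m) (by fun_prop)) fun k => (hf k).2.1 m
  · exact ge_of_tendsto' (hlim ((differentiable_rfPower m).continuous.comp continuous_fst))
      fun k => (hf k).2.2.1 m
  · exact le_of_tendsto' (hlim (differentiable_power.continuous.comp continuous_fst))
      fun k => (hf k).2.2.2

/-- At a limit point the first two blocks are optimal, and no strictly feasible point of the third
block problem improves on it. -/
lemma block_optimal_of_isLimitPoint (hM : 0 < M) (hσI : 0 < c.σI) (hσE : ∀ m, 0 < c.σE m)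
    (hp : 0 < c.p) {x : ℕ → Vars Ns M} (hx : IsRun H θ c x) {b : Beam Ns M} {z : ℝ} {u : ℂ}
    {v : ℝ} {y : Fin M → ℝ} (hlim : IsLimitPoint x (b, z, u, v, y)) :
    z = (mse H θ c b u)⁻¹ ∧ v = (∑ m, (1 + y m) ^ c.p)⁻¹ ∧ u = receiver H θ c b ∧
    ∀ q ∈ (step3 H θ c b z u v).dom, (∀ j, (step3 H θ c b z u v).con j q < 0) →
      surrogate H θ c (b, z, u, v, y) ≤ surrogate H θ c (q.1, z, u, v, q.2) := by
  have hfeas := feasible_of_isLimitPoint hσI hσE hp hx hlim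
  obtain ⟨⟨hz, hv⟩, hsy, -⟩ := reformulated_feasible_iff.1 hfeas
  simp only at hz hv hsy
  have hy : ∀ m, 0 ≤ y m := fun m => (sinrE_nonneg hσE m b).trans (hsy m)
  have hS := sum_rpow_pos hM hy c.p
  have he := mse_pos (H := H) (θ := θ) hσI b u
  obtain ⟨φ, hmono, hφ⟩ := hlim
  have hxf := feasible_of_isRun hx
  have hanti := antitone_surrogate hσE hx
  have hval : Tendsto (fun k => surrogate H θ c (x (φ k))) atTop
      (𝓝 (surrogate H θ c (b, z, u, v, y))) :=
    (differentiableAt_surrogate hz hv hy).continuousAt.tendsto.comp hφ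
  have hval_le : ∀ i, surrogate H θ c (b, z, u, v, y) ≤ surrogate H θ c (x i) := by
    intro i
    refine le_of_tendsto hval ?_
    filter_upwards [eventually_ge_atTop i] with k hk
    exact hanti (hk.trans (hmono.id_le k))
  have hb : Tendsto (fun k => (x (φ k)).1) atTop (𝓝 b) := (continuous_fst.tendsto _).comp hφ
  have hu : Tendsto (fun k => (x (φ k)).2.2.1) atTop (𝓝 u) :=
    ((continuous_fst.comp (continuous_snd.comp continuous_snd)).tendsto _).comp hφ
  have hyk : Tendsto (fun k => (x (φ k)).2.2.2.2) atTop (𝓝 y) :=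
    ((continuous_snd.comp (continuous_snd.comp (continuous_snd.comp continuous_snd))).tendsto
      _).comp hφ
  -- The updates leading from `φ k` to `φ k + 1`. The latter need not belong to the subsequence, so
  -- nothing is assumed about convergence of its beams or `y`.
  have hit := fun k => isIteration_iff.1 (hx.2 (φ k))
  have hz' : Tendsto (fun k => (x (φ k + 1)).2.1) atTop (𝓝 (mse H θ c b u)⁻¹) := by
    have h1 : Tendsto (fun k => (mse H θ c (x (φ k)).1 (x (φ k)).2.2.1)⁻¹) atTop
        (𝓝 (mse H θ c b u)⁻¹) :=
      ((differentiable_mse.continuous.tendsto (b, u)).comp (hb.prodMk_nhds hu)).inv₀ he.ne'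
    refine h1.congr fun k => ?_
    have hy' := fun m => (sinrE_nonneg hσE m _).trans
      ((reformulated_feasible_iff.1 (hxf (φ k))).2.1 m)
    exact (step1_minimizer_eq hp (mse_pos hσI _ _) (sum_rpow_pos hM hy' _) (hit k).1).1.symm
  have hv' : Tendsto (fun k => (x (φ k + 1)).2.2.2.1) atTop
      (𝓝 (∑ m, (1 + y m) ^ c.p)⁻¹) := by
    have h1 : Tendsto (fun k => (∑ m, (1 + (x (φ k)).2.2.2.2 m) ^ c.p)⁻¹) atTop
        (𝓝 (∑ m, (1 + y m) ^ c.p)⁻¹) := by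
      refine (tendsto_finsetSum _ fun m _ => ?_).inv₀ hS.ne'
      exact ((((continuous_apply m).tendsto y).comp hyk).const_add 1).rpow_const
        (Or.inl (by have := hy m; positivity))
    refine h1.congr fun k => ?_
    have hy' := fun m => (sinrE_nonneg hσE m _).trans
      ((reformulated_feasible_iff.1 (hxf (φ k))).2.1 m)
    exact (step1_minimizer_eq hp (mse_pos hσI _ _) (sum_rpow_pos hM hy' _) (hit k).1).2.symm
  have hu' : Tendsto (fun k => (x (φ k + 1)).2.2.1) atTop (𝓝 (receiver H θ c b)) := by
    refine (((continuous_receiver hσI).tendsto b).comp hb).congr fun k => ?_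
    exact (step2_minimizer_eq hσI (hit k).2.1).symm
  -- The points reached after the first block converge, and their values lie above the limit value.
  -- So `(z, v)` does no worse than the unique minimizer of the limiting first block.
  have hzv : z = (mse H θ c b u)⁻¹ ∧ v = (∑ m, (1 + y m) ^ c.p)⁻¹ := by
    refine eq_inv_of_surrogate_le hp he hS hz hv ?_
    refine ge_of_tendsto' (((differentiableAt_surrogate (inv_pos.2 he) (inv_pos.2 hS)
      hy).continuousAt.tendsto).comp
      (hb.prodMk_nhds (hz'.prodMk_nhds (hu.prodMk_nhds (hv'.prodMk_nhds hyk))))) fun k => ?_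
    exact (hval_le (φ k + 1)).trans ((surrogate_le_of_isIteration hσE (hxf _) (hx.2 _)).trans
      (surrogate_blocks_le (hxf _) (hx.2 _)).1)
  rw [← hzv.1] at hz'
  rw [← hzv.2] at hv'
  -- The same argument for the points reached after the second block.
  have huo : u = receiver H θ c b := by
    have h1 : surrogate H θ c (b, z, u, v, y) ≤
        surrogate H θ c (b, z, receiver H θ c b, v, y) := by
      refine ge_of_tendsto' (((differentiableAt_surrogate hz hv hy).continuousAt.tendsto).comp
        (hb.prodMk_nhds (hz'.prodMk_nhds (hu'.prodMk_nhds (hv'.prodMk_nhds hyk))))) fun k => ?_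
      exact (hval_le (φ k + 1)).trans (surrogate_le_of_isIteration hσE (hxf _) (hx.2 _))
    rw [surrogate_apply, surrogate_apply, mse_receiver hσI] at h1
    exact eq_receiver_of_mse_le hσI (le_of_mul_le_mul_left (by linarith) hz)
  rw [← huo] at hu'
  refine ⟨hzv.1, hzv.2, huo, fun q hq hqcon => ?_⟩
  -- Keeps `1 + q.2 m` away from zero, so that the surrogate is continuous at the competitor.
  have hqy : ∀ m, 0 ≤ q.2 m := fun m => by
    have h1 : infoGain (gEff H θ m) q.1 / denLin H θ c b m q.1 - q.2 m < 0 := hqcon (.inl m)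
    have h2 := div_nonneg (infoGain_nonneg (gEff H θ m) q.1) (hq m).le
    linarith
  refine ge_of_tendsto (((differentiableAt_surrogate hz hv hqy).continuousAt.tendsto).comp
    ((tendsto_const_nhds (x := q.1)).prodMk_nhds (hz'.prodMk_nhds (hu'.prodMk_nhds
      (hv'.prodMk_nhds tendsto_const_nhds))))) ?_
  have hden : ∀ m, Continuous fun f => denLin H θ c f m q.1 := fun m =>
    (continuous_energyGainLin_left (gEff H θ m) q.1).add continuous_const
  have hdomk : ∀ᶠ k in atTop, ∀ m, 0 < denLin H θ c (x (φ k)).1 m q.1 :=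
    eventually_all.2 fun m => (((hden m).tendsto b).comp hb).eventually_const_lt (hq m)
  -- The constraints move with the expansion point; only strict inequalities are sure to survive,
  -- which is why competitors must be strictly feasible.
  have hconk : ∀ᶠ k in atTop, ∀ j, (step3 H θ c (x (φ k)).1 (x (φ k + 1)).2.1
      (x (φ k + 1)).2.2.1 (x (φ k + 1)).2.2.2.1).con j q < 0 := by
    refine eventually_all.2 fun j => ?_
    rcases j with m | m | t
    · exact ((tendsto_const_nhds.div (((hden m).tendsto b).comp hb) (hq m).ne').sub_const
        (q.2 m)).eventually_lt_const (hqcon (.inl m))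
    · have h1 := ((continuous_infoGainLin_left (gEff H θ m) q.1).add
        (continuous_energyGainLin_left (gEff H θ m) q.1)).tendsto b
      exact ((h1.comp hb).const_sub (c.ε m)).eventually_lt_const (hqcon (.inr (.inl m)))
    · exact Eventually.of_forall fun _ => hqcon (.inr (.inr t))
  filter_upwards [hdomk, hconk] with k h1 h2
  exact (hval_le (φ k + 1)).trans ((hit k).2.2.2 q ⟨h1, fun j => (h2 j).le⟩)

end SecureSWIPT

namespace SecureSWIPT

variable {Ns Nr M : ℕ} {H : Channels Ns Nr M} {θ : Fin Nr → ℝ} {c : Params M}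

/-! ### KKT conditions -/

/-- A directional derivative depends only on the restriction to a line, so functions on different
spaces can be compared. -/
lemma fderiv_apply_eq_of_line {E F : Type*} [NormedAddCommGroup E] [NormedSpace ℝ E]
    [NormedAddCommGroup F] [NormedSpace ℝ F] {f : E → ℝ} {g : F → ℝ} {x d : E} {x' d' : F}
    (hf : DifferentiableAt ℝ f x) (hg : DifferentiableAt ℝ g x')
    (h : ∀ t : ℝ, f (x + t • d) = g (x' + t • d')) : fderiv ℝ f x d = fderiv ℝ g x' d' := by
  have h1 := hasDerivAt_line hf d
  rw [funext h] at h1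
  exact h1.unique (hasDerivAt_line hg d')

lemma fderiv_apply_eq_zero_of_forall_le {E : Type*} [NormedAddCommGroup E] [NormedSpace ℝ E]
    {f : E → ℝ} {x d : E} (hf : DifferentiableAt ℝ f x)
    (h : ∀ᶠ t : ℝ in 𝓝 0, f x ≤ f (x + t • d)) : fderiv ℝ f x d = 0 := by
  have hmin : IsLocalMin (fun t : ℝ => f (x + t • d)) 0 := by
    filter_upwards [h] with t ht
    simpa using ht
  exact hmin.hasDerivAt_eq_zero (hasDerivAt_line hf d)

lemma differentiable_blockCon (hσE : ∀ m, 0 < c.σE m) (j : Fin M ⊕ Fin M ⊕ Unit) :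
    Differentiable ℝ (blockCon H θ c j) := by
  rcases j with m | m | _
  · exact ((differentiable_sinrE hσE m).comp differentiable_fst).sub (by fun_prop)
  · exact ((differentiable_rfPower m).comp differentiable_fst).const_sub _
  · exact (differentiable_power.comp differentiable_fst).sub_const _

lemma differentiable_denLin (f : Beam Ns M) (m : Fin M) : Differentiable ℝ (denLin H θ c f m) :=
  (differentiable_energyGainLin _ f).add_const _

lemma isOpen_step3_dom (f : Beam Ns M) (z : ℝ) (u : ℂ) (v : ℝ) :
    IsOpen (step3 H θ c f z u v).dom := by
  simp only [step3, Set.ofPred_forall]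
  exact isOpen_iInter_of_finite fun m =>
    isOpen_lt continuous_const ((differentiable_denLin f m).continuous.comp continuous_fst)

lemma differentiableAt_step3_con {f : Beam Ns M} {z : ℝ} {u : ℂ} {v : ℝ}
    {q : Beam Ns M × (Fin M → ℝ)} (hq : q ∈ (step3 H θ c f z u v).dom)
    (j : Fin M ⊕ Fin M ⊕ Unit) : DifferentiableAt ℝ ((step3 H θ c f z u v).con j) q := by
  rcases j with m | m | _
  · refine DifferentiableAt.sub (differentiableAt_div
      (((differentiable_infoGain _).comp differentiable_fst) q)
      (((differentiable_denLin f m).comp differentiable_fst) q) (hq m).ne') (by fun_prop)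
  · exact ((((differentiable_infoGainLin _ f).add (differentiable_energyGainLin _ f)).comp
      differentiable_fst).const_sub _) q
  · exact ((differentiable_power.comp differentiable_fst).sub_const _) q

/-- A differentiable majorant that touches has the same derivative, so no gradient of a
linearization has to be computed. -/
lemma fderiv_step3_con_self (hσE : ∀ m, 0 < c.σE m) (b : Beam Ns M) (z : ℝ) (u : ℂ) (v : ℝ)
    (y : Fin M → ℝ) (j : Fin M ⊕ Fin M ⊕ Unit) :
    fderiv ℝ ((step3 H θ c b z u v).con j) (b, y) = fderiv ℝ (blockCon H θ c j) (b, y) := by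
  have hdom := mem_step3_dom_self (H := H) (θ := θ) hσE b z u v y
  refine (fderiv_eq_of_eventually_le (differentiable_blockCon hσE j _)
    (differentiableAt_step3_con hdom j) ?_ (step3_con_self b z u v y j).symm).symm
  filter_upwards [(isOpen_step3_dom b z u v).mem_nhds hdom] with q hq
  exact blockCon_le_step3_con hq j

lemma differentiable_reformulated_con (hσE : ∀ m, 0 < c.σE m) (j : Fin M ⊕ Fin M ⊕ Unit) :
    Differentiable ℝ ((reformulated (Ns := Ns) H θ c).con j) := by
  rw [funext (reformulated_con j)]
  exact (differentiable_blockCon hσE j).comp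
    (differentiable_fst.prodMk (by fun_prop : Differentiable ℝ fun x : Vars Ns M => x.2.2.2.2))

lemma step3_isKKT {b : Beam Ns M} {z : ℝ} {u : ℂ} {v : ℝ} {y : Fin M → ℝ}
    (hσE : ∀ m, 0 < c.σE m)
    (hfeas : (reformulated H θ c).Feasible (b, z, u, v, y))
    (hmin : ∀ q ∈ (step3 H θ c b z u v).dom, (∀ j, (step3 H θ c b z u v).con j q < 0) →
      surrogate H θ c (b, z, u, v, y) ≤ surrogate H θ c (q.1, z, u, v, q.2))
    (hslater : (step3 H θ c b z u v).Slater) : (step3 H θ c b z u v).IsKKT (b, y) := by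
  obtain ⟨⟨hz, hv⟩, hsy, -⟩ := reformulated_feasible_iff.1 hfeas
  have hdom := mem_step3_dom_self (H := H) (θ := θ) hσE b z u v y
  have hcon := differentiableAt_step3_con hdom
  obtain ⟨d, hd⟩ := OptProblem.exists_linearized_lt_of_slater hslater
    (convexOn_step3_con b z u v) hdom hcon
  refine OptProblem.isKKT_of_forall_strictly_feasible (step3_feasible_self hσE hfeas _ _ _)
    ((isOpen_step3_dom b z u v).mem_nhds hdom) ?_ hcon d hd hmin
  have h1 : Differentiable ℝ fun q : Beam Ns M × (Fin M → ℝ) =>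
      ((q.1, z, u, v, q.2) : Vars Ns M) := by fun_prop
  have h2 : DifferentiableAt ℝ (surrogate H θ c) (b, z, u, v, y) :=
    differentiableAt_surrogate hz hv fun m => (sinrE_nonneg hσE m b).trans (hsy m)
  exact DifferentiableAt.comp (g := surrogate H θ c) (b, y) h2 (h1 (b, y))

/-- A point that is optimal in the first two blocks and a KKT point in the third one is a KKT
point of the reformulated problem. -/
lemma reformulated_isKKT (hM : 0 < M) (hσI : 0 < c.σI) (hσE : ∀ m, 0 < c.σE m) (hp : 0 < c.p)
    {b : Beam Ns M} {z : ℝ} {u : ℂ} {v : ℝ} {y : Fin M → ℝ}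
    (hfeas : (reformulated H θ c).Feasible (b, z, u, v, y))
    (hz : z = (mse H θ c b u)⁻¹) (hv : v = (∑ m, (1 + y m) ^ c.p)⁻¹) (hu : u = receiver H θ c b)
    (hkkt : (step3 H θ c b z u v).IsKKT (b, y)) :
    (reformulated H θ c).IsKKT (b, z, u, v, y) := by
  obtain ⟨⟨hz0, hv0⟩, hsy, -⟩ := reformulated_feasible_iff.1 hfeas
  simp only at hz0 hv0 hsy
  have hy : ∀ m, 0 ≤ y m := fun m => (sinrE_nonneg hσE m b).trans (hsy m)
  have hS := sum_rpow_pos hM hy c.p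
  have he := mse_pos (H := H) (θ := θ) hσI b u
  obtain ⟨-, -, hobj3, -, μ, hμ, hcs, hst⟩ := hkkt
  have hobj : DifferentiableAt ℝ (surrogate H θ c) (b, z, u, v, y) :=
    differentiableAt_surrogate hz0 hv0 hy
  have hcon := differentiable_reformulated_con (Ns := Ns) (H := H) (θ := θ) hσE
  refine ⟨hfeas, ?_, hobj, fun j => hcon j _, μ, hμ, fun j => ?_, ?_⟩
  · exact ((isOpen_lt continuous_const (by fun_prop)).inter
      (isOpen_lt continuous_const (by fun_prop))).mem_nhds (⟨hz0, hv0⟩ :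
        (b, z, u, v, y) ∈ {x : Vars Ns M | 0 < x.2.1} ∩ {x : Vars Ns M | 0 < x.2.2.2.1})
  · rw [reformulated_con, ← step3_con_self b z u v]
    exact hcs j
  · refine ContinuousLinearMap.ext fun d => ?_
    obtain ⟨db, dz, du, dv, dy⟩ := d
    -- The direction is split by blocks. The objective is stationary along `(z, v)` and along `u` by
    -- block optimality, and the constraints do not involve these variables, so the third block's
    -- multipliers serve unchanged.
    have hzv : fderiv ℝ (surrogate H θ c) (b, z, u, v, y) (0, dz, 0, dv, 0) = 0 := by
      refine fderiv_apply_eq_zero_of_forall_le hobj ?_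
      have h1 : ∀ᶠ t : ℝ in 𝓝 0, 0 < z + t * dz :=
        (by fun_prop : Continuous fun t : ℝ => z + t * dz).continuousAt.eventually_const_lt
          (by simpa using hz0)
      have h2 : ∀ᶠ t : ℝ in 𝓝 0, 0 < v + t * dv :=
        (by fun_prop : Continuous fun t : ℝ => v + t * dv).continuousAt.eventually_const_lt
          (by simpa using hv0)
      filter_upwards [h1, h2] with t h1 h2
      have h3 := le_surrogate (H := H) (θ := θ) hp he hS h1 h2
      rw [← surrogate_inv he hS, ← hz, ← hv] at h3
      simpa using h3
    have hu' : fderiv ℝ (surrogate H θ c) (b, z, u, v, y) (0, 0, du, 0, 0) = 0 := by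
      refine fderiv_apply_eq_zero_of_forall_le hobj (Eventually.of_forall fun t => ?_)
      have h3 : surrogate H θ c (b, z, u, v, y) ≤ surrogate H θ c (b, z, u + t • du, v, y) := by
        rw [surrogate_apply, surrogate_apply]
        have h4 := inv_le_mse (H := H) (θ := θ) hσI b (u + t • du)
        rw [← mse_receiver hσI, ← hu] at h4
        have h5 := mul_le_mul_of_nonneg_left h4 hz0.le
        linarith
      simpa using h3
    have hby : fderiv ℝ (surrogate H θ c) (b, z, u, v, y) (db, 0, 0, 0, dy) =
        fderiv ℝ (step3 H θ c b z u v).obj (b, y) (db, dy) := by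
      refine fderiv_apply_eq_of_line hobj hobj3 fun t => ?_
      simp [step3]
    have hc : ∀ j, fderiv ℝ ((reformulated H θ c).con j) (b, z, u, v, y) (db, dz, du, dv, dy) =
        fderiv ℝ ((step3 H θ c b z u v).con j) (b, y) (db, dy) := by
      intro j
      rw [fderiv_step3_con_self hσE]
      refine fderiv_apply_eq_of_line (hcon j _) (differentiable_blockCon hσE j _) fun t => ?_
      rw [reformulated_con]
      rfl
    have hsplit : ((db, dz, du, dv, dy) : Vars Ns M) =
        (db, 0, 0, 0, dy) + (0, dz, 0, dv, 0) + (0, 0, du, 0, 0) := by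
      simp
    have hobjd : fderiv ℝ (reformulated H θ c).obj (b, z, u, v, y) (db, dz, du, dv, dy) =
        fderiv ℝ (step3 H θ c b z u v).obj (b, y) (db, dy) := by
      change fderiv ℝ (surrogate H θ c) (b, z, u, v, y) (db, dz, du, dv, dy) = _
      rw [hsplit, map_add, map_add, hzv, hu', hby, add_zero, add_zero]
    have h := DFunLike.congr_fun hst (db, dy)
    simp only [_root_.add_apply, _root_.sum_apply,
      _root_.smul_apply, _root_.zero_apply] at h ⊢
    rw [hobjd]
    simpa only [hc] using h

/-- At a KKT point of the reformulated problem the constraints on the eavesdroppers are tight. -/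
lemma eq_sinrE_of_isKKT (hσE : ∀ m, 0 < c.σE m) (hp : 0 < c.p)
    {b : Beam Ns M} {z : ℝ} {u : ℂ} {v : ℝ} {y : Fin M → ℝ}
    (h : (reformulated H θ c).IsKKT (b, z, u, v, y)) (m : Fin M) : y m = sinrE H θ c m b := by
  classical
  obtain ⟨hfeas, -, hobj, hcon, μ, hμ, hcs, hst⟩ := h
  obtain ⟨⟨hz0, hv0⟩, hsy, -⟩ := reformulated_feasible_iff.1 hfeas
  simp only at hz0 hv0 hsy
  have hy : ∀ m, 0 ≤ y m := fun m => (sinrE_nonneg hσE m b).trans (hsy m)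
  let d : Vars Ns M := (0, 0, 0, 0, Pi.single m 1)
  have hd : ∀ t : ℝ, (b, z, u, v, y) + t • d = (b, z, u, v, y + t • Pi.single m 1) := fun t => by
    simp [d]
  have h1 : fderiv ℝ (reformulated H θ c).obj (b, z, u, v, y) d = v * (1 + y m) ^ (c.p - 1) := by
    refine (hasDerivAt_line hobj d).unique ?_
    have e : ∀ t : ℝ, (reformulated H θ c).obj ((b, z, u, v, y) + t • d) =
        (z * mse H θ c b u - Real.log z) + 1 / c.p * (v * (∑ k, (1 + (y k + t *
          (Pi.single m (1 : ℝ) : Fin M → ℝ) k)) ^ c.p) - Real.log v) := fun t => by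
      rw [hd]
      exact surrogate_apply _ _ _ _ _
    rw [funext e]
    have hk : ∀ k ∈ Finset.univ, HasDerivAt
        (fun t : ℝ => (1 + (y k + t * (Pi.single m (1 : ℝ) : Fin M → ℝ) k)) ^ c.p)
        ((Pi.single m (1 : ℝ) : Fin M → ℝ) k * c.p * (1 + y k) ^ (c.p - 1)) 0 := by
      intro k _
      have h2 : HasDerivAt (fun t : ℝ => 1 + (y k + t * (Pi.single m (1 : ℝ) : Fin M → ℝ) k))
          ((Pi.single m (1 : ℝ) : Fin M → ℝ) k) 0 := by
        simpa using (((hasDerivAt_id (0 : ℝ)).mul_const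
          ((Pi.single m (1 : ℝ) : Fin M → ℝ) k)).const_add (y k)).const_add 1
      have h3 := h2.rpow_const (p := c.p) (Or.inl (by have := hy k; simp; positivity))
      simpa using h3
    have h3 := ((((HasDerivAt.fun_sum hk).const_mul v).sub_const (Real.log v)).const_mul
      (1 / c.p)).const_add (z * mse H θ c b u - Real.log z)
    refine h3.congr_deriv ?_
    simp only [Pi.single_apply, ite_mul, one_mul, zero_mul, Finset.sum_ite_eq',
      Finset.mem_univ, if_true]
    field_simp
  have h2 : ∀ j, fderiv ℝ ((reformulated H θ c).con j) (b, z, u, v, y) d =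
      if j = .inl m then -1 else 0 := by
    intro j
    refine (hasDerivAt_line (hcon j) d).unique ?_
    have e : ∀ t : ℝ, (reformulated H θ c).con j ((b, z, u, v, y) + t • d) =
        (if j = .inl m then -1 else 0) * t + blockCon H θ c j (b, y) := fun t => by
      rw [hd, reformulated_con]
      rcases j with k | k | k
      · simp only [blockCon, Pi.add_apply, Pi.smul_apply, Pi.single_apply, smul_eq_mul,
          Sum.inl.injEq]
        split_ifs <;> ring
      · simp [blockCon]
      · simp [blockCon]
    rw [funext e]
    simpa using ((hasDerivAt_id (0 : ℝ)).const_mul (if j = .inl m then (-1 : ℝ) else 0)).add_const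
      (blockCon H θ c j (b, y))
  have h3 := DFunLike.congr_fun hst d
  simp only [_root_.add_apply, _root_.sum_apply,
    _root_.smul_apply, _root_.zero_apply, h1, h2, smul_eq_mul, mul_ite,
    mul_neg, mul_one, mul_zero, Finset.sum_ite_eq', Finset.mem_univ, if_true] at h3
  -- Stationarity in `y m` equates this quantity with the multiplier `μ (.inl m)`; its positivity
  -- activates complementary slackness.
  have h4 : 0 < v * (1 + y m) ^ (c.p - 1) := by
    have := hy m
    positivity
  have h5 : sinrE H θ c m b - y m = 0 :=
    (mul_eq_zero.1 (hcs (.inl m))).resolve_left (by linarith)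
  linarith

/-- Each of the two dualized logarithms contributes its own unit, weighted by `1` and `1 / p`; hence
the constant. -/
lemma neg_secrecyRate_add_le_surrogate (hM : 0 < M) (hσI : 0 < c.σI) (hσE : ∀ m, 0 < c.σE m)
    (hp : 0 < c.p) (b : Beam Ns M) {z : ℝ} (u : ℂ) {v : ℝ} (hz : 0 < z) (hv : 0 < v) :
    -secrecyRate H θ c b + (1 + 1 / c.p) ≤
      surrogate H θ c (b, z, u, v, fun m => sinrE H θ c m b) := by
  have hS := sum_rpow_pos hM (fun m => sinrE_nonneg (H := H) (θ := θ) hσE m b) c.p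
  refine le_trans ?_ (le_surrogate hp (mse_pos hσI b u) hS hz hv)
  have h1 := sinrI_nonneg (H := H) (θ := θ) hσI b
  have h2 := Real.log_le_log (by positivity) (inv_le_mse (H := H) (θ := θ) hσI b u)
  rw [Real.log_inv] at h2
  rw [secrecyRate]
  linarith

lemma neg_secrecyRate_add_eq_surrogate (hM : 0 < M) (hσI : 0 < c.σI) (hσE : ∀ m, 0 < c.σE m)
    {b : Beam Ns M} {z : ℝ} {u : ℂ} {v : ℝ} {y : Fin M → ℝ}
    (hz : z = (mse H θ c b u)⁻¹) (hv : v = (∑ m, (1 + y m) ^ c.p)⁻¹) (hu : u = receiver H θ c b)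
    (hy : y = fun m => sinrE H θ c m b) :
    -secrecyRate H θ c b + (1 + 1 / c.p) = surrogate H θ c (b, z, u, v, y) := by
  have hS := sum_rpow_pos hM (fun m => sinrE_nonneg (H := H) (θ := θ) hσE m b) c.p
  subst hy
  rw [hz, hv, surrogate_inv (mse_pos hσI b u) hS, hu, mse_receiver hσI, Real.log_inv, secrecyRate]
  ring

lemma differentiable_secrecyRate (hM : 0 < M) (hσI : 0 < c.σI) (hσE : ∀ m, 0 < c.σE m) :
    Differentiable ℝ (secrecyRate (Ns := Ns) H θ c) := by
  intro b
  have h1 : DifferentiableAt ℝ (fun b => Real.log (1 + sinrI H θ c b)) b :=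
    DifferentiableAt.log ((differentiable_sinrI hσI b).const_add 1)
      (by have := sinrI_nonneg (H := H) (θ := θ) hσI b; positivity)
  have h2 : DifferentiableAt ℝ (fun b => Real.log (∑ m, (1 + sinrE H θ c m b) ^ c.p)) b := by
    refine DifferentiableAt.log (DifferentiableAt.fun_sum fun m _ => ?_)
      (sum_rpow_pos hM (fun m => sinrE_nonneg hσE m b) c.p).ne'
    exact ((differentiable_sinrE hσE m b).const_add 1).rpow_const
      (Or.inl (by have := sinrE_nonneg (H := H) (θ := θ) hσE m b; positivity))
  exact h1.sub (h2.const_mul _)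

/-- A KKT point of the reformulated problem that is optimal in the first two blocks yields a KKT
point of the short-term problem. -/
lemma shortTerm_isKKT (hM : 0 < M) (hσI : 0 < c.σI) (hσE : ∀ m, 0 < c.σE m) (hp : 0 < c.p)
    {b : Beam Ns M} {z : ℝ} {u : ℂ} {v : ℝ} {y : Fin M → ℝ}
    (hz : z = (mse H θ c b u)⁻¹) (hv : v = (∑ m, (1 + y m) ^ c.p)⁻¹) (hu : u = receiver H θ c b)
    (h : (reformulated H θ c).IsKKT (b, z, u, v, y)) : (shortTerm H θ c).IsKKT b := by
  obtain rfl : y = fun m => sinrE H θ c m b := funext (eq_sinrE_of_isKKT hσE hp h)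
  obtain ⟨hfeas, -, hobj, hcon, μ, hμ, hcs, hst⟩ := h
  obtain ⟨⟨hz0, hv0⟩, -, hrf, hpow⟩ := reformulated_feasible_iff.1 hfeas
  have hrate := differentiable_secrecyRate (Ns := Ns) (H := H) (θ := θ) hM hσI hσE
  have hcon' : ∀ j, Differentiable ℝ ((shortTerm (Ns := Ns) H θ c).con j) := by
    rintro (m | _)
    · exact (differentiable_rfPower m).const_sub _
    · exact differentiable_power.sub_const _
  -- Along this curve the SINR constraints hold with equality, while `z`, `u`, `v` stay frozen at
  -- their optimal values for `b`.
  let curve : Beam Ns M → Vars Ns M := fun b' => (b', z, u, v, fun m => sinrE H θ c m b')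
  have hcurve : Differentiable ℝ curve :=
    differentiable_id.prodMk ((differentiable_const z).prodMk ((differentiable_const u).prodMk
      ((differentiable_const v).prodMk (differentiable_pi.2 fun m => differentiable_sinrE hσE m))))
  -- The surrogate along the curve majorizes the negative rate plus a constant and touches it at
  -- `b`, so the two derivatives agree.
  have hobj_comp : fderiv ℝ (shortTerm H θ c).obj b =
      (fderiv ℝ (reformulated H θ c).obj (curve b)).comp (fderiv ℝ curve b) := by
    rw [← fderiv_comp b hobj (hcurve b),
      ← fderiv_eq_of_eventually_le (f := fun b => (shortTerm H θ c).obj b + (1 + 1 / c.p))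
        ((hrate.neg b).add_const _) (hobj.comp b (hcurve b)) ?_ ?_, fderiv_add_const]
    · exact Eventually.of_forall fun b' =>
        neg_secrecyRate_add_le_surrogate hM hσI hσE hp b' u hz0 hv0
    · exact neg_secrecyRate_add_eq_surrogate hM hσI hσE hz hv hu rfl
  have hcon_comp : ∀ j, fderiv ℝ ((reformulated H θ c).con j ∘ curve) b =
      (fderiv ℝ ((reformulated H θ c).con j) (curve b)).comp (fderiv ℝ curve b) := fun j =>
    fderiv_comp b (hcon j) (hcurve b)
  have hinl : ∀ m, fderiv ℝ ((reformulated H θ c).con (.inl m) ∘ curve) b = 0 := fun m => by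
    have e : (reformulated H θ c).con (.inl m) ∘ curve = fun _ => (0 : ℝ) :=
      funext fun b' => sub_self (sinrE H θ c m b')
    rw [e]
    simp
  -- The SINR multipliers can be discarded, because their constraints are identically zero along the
  -- curve.
  refine ⟨⟨Set.mem_univ _, ?_⟩, univ_mem, hrate.neg b, fun j => hcon' j b, fun j => μ (.inr j),
    fun j => hμ _, ?_, ?_⟩
  · rintro (m | _)
    · exact sub_nonpos.2 (hrf m)
    · exact sub_nonpos.2 hpow
  · rintro (m | k)
    · exact hcs (.inr (.inl m))
    · exact hcs (.inr (.inr k))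
  · have h1 : (fderiv ℝ (reformulated H θ c).obj (curve b)).comp (fderiv ℝ curve b) +
        ∑ j, μ j • (fderiv ℝ ((reformulated H θ c).con j) (curve b)).comp (fderiv ℝ curve b) =
        0 := by
      refine ContinuousLinearMap.ext fun d => ?_
      have := DFunLike.congr_fun hst (fderiv ℝ curve b d)
      simpa using this
    simp only [← hcon_comp, ← hobj_comp, Fintype.sum_sum_type (α₁ := Fin M) (α₂ := Fin M ⊕ Unit),
      hinl, smul_zero, Finset.sum_const_zero, zero_add] at h1
    rw [← h1]
    congr 1
    refine Finset.sum_congr rfl fun j _ => ?_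
    rcases j with m | k <;> rfl

end SecureSWIPT

theorem theorem2 {Ns Nr M : ℕ} (hM : 0 < M)
    (H : SecureSWIPT.Channels Ns Nr M) (θ : Fin Nr → ℝ) (c : SecureSWIPT.Params M)
    (hσI : 0 < c.σI) (hσE : ∀ m, 0 < c.σE m) (hp : 0 < c.p)
    (x : ℕ → SecureSWIPT.Vars Ns M) (hx : SecureSWIPT.IsRun H θ c x) :
    Antitone (fun i => SecureSWIPT.surrogate H θ c (x i)) ∧
    (∀ i, (SecureSWIPT.reformulated H θ c).Feasible (x i)) ∧
    (∀ xlim : SecureSWIPT.Vars Ns M, SecureSWIPT.IsLimitPoint x xlim →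
      SecureSWIPT.SlaterAt H θ c xlim →
      (SecureSWIPT.reformulated H θ c).IsKKT xlim ∧
      (SecureSWIPT.shortTerm H θ c).IsKKT xlim.1) := by
  refine ⟨SecureSWIPT.antitone_surrogate hσE hx, SecureSWIPT.feasible_of_isRun hx, ?_⟩
  rintro ⟨b, z, u, v, y⟩ hlim hslater
  have hfeas := SecureSWIPT.feasible_of_isLimitPoint hσI hσE hp hx hlim
  obtain ⟨hz, hv, hu, hmin⟩ :=
    SecureSWIPT.block_optimal_of_isLimitPoint hM hσI hσE hp hx hlim
  have hkkt := SecureSWIPT.reformulated_isKKT hM hσI hσE hp hfeas hz hv hu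
    (SecureSWIPT.step3_isKKT hσE hfeas hmin hslater)
  exact ⟨hkkt, SecureSWIPT.shortTerm_isKKT hM hσI hσE hp hz hv hu hkkt⟩
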